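/- Lemma (homotopy invariance of locally constant stacks). "2-category" means bicategory, "2-functor" pseudofunctor, "2-transformation" pseudonatural transformation. For a topological space $X$ (no further condition) and a small 2-category $\mathbf C$, let $\mathbf C_X$ be the constant 2-stack on $X$ with stalk $\mathbf C$, i.e. the 2-stack associated with the constant 2-prestack, and let $\mathbf\Gamma_X(\mathbf C)=\mathbf C_X(X)$ be the 2-category of its global sections, called locally constant stacks on $X$ with values in $\mathbf C$. Every 2-functor $G\colon\mathbf C\to\mathbf D$ induces a 2-functor $\mathbf\Gamma_X(\mathbf C)\to\mathbf\Gamma_X(\mathbf D)$, and every continuous map $f\colon X\to Y$ induces inverse image 2-functors $f^{-1}\colon\mathbf\Gamma_Y(\mathbf C)\to\mathbf\Gamma_X(\mathbf C)$, which are natural in $\mathbf C$, i.e. form a 3-transformation $\mathbf\Gamma_Y\to\mathbf\Gamma_X$. Let $I=[0,1]$, $t\in I$, let $p\colon X\times I\to X$ be the projection and $\iota_t\colon X\to X\times I$, $\iota_t(x)=(x,t)$. Then the 3-transformations $p^{-1}\colon\mathbf\Gamma_X\to\mathbf\Gamma_{X\times I}$ and $\iota_t^{-1}\colon\mathbf\Gamma_{X\times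 I}\to\mathbf\Gamma_X$ are equivalences, quasi-inverse to each other. That is: for every small 2-category $\mathbf C$ there are equivalences of 2-functors $$\iota_t^{-1}\circ p^{-1}\simeq \mathrm{Id}_{\mathbf\Gamma_X(\mathbf C)},\qquad p^{-1}\circ\iota_t^{-1}\simeq \mathrm{Id}_{\mathbf\Gamma_{X\times I}(\mathbf C)},$$ and they can be chosen natural in $\mathbf C$: for every 2-functor $G\colon\mathbf C\to\mathbf D$ they commute with the 2-functors induced by $G$ up to an invertible modification, and these modifications are natural with respect to 2-transformations $G\to G'$ and compatible with identities and composition of 2-functors. In particular, every $\mathfrak S\in\mathbf\Gamma_{X\times I}(\mathbf C)$ is equivalent to $p^{-1}\iota_t^{-1}\mathfrak S$. -/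

import Mathlib

open CategoryTheory Bicategory Topology Filter
open scoped Pseudofunctor.StrongTrans

universe w v u w' v' u' w'' v'' u'' z

namespace HigherMonodromy

/-- A 1-arrow of a 2-category (bicategory) which is invertible up to invertible 2-arrows. -/
def IsEquivalence₁ {C : Type u} [Bicategory.{w, v} C] {p q : C} (f : p ⟶ q) : Prop :=
  ∃ g : q ⟶ p, Nonempty (f ≫ g ≅ 𝟙 p) ∧ Nonempty (g ≫ f ≅ 𝟙 q)

theorem IsEquivalence₁.map {C : Type u} [Bicategory.{w, v} C] {D : Type u'} [Bicategory.{w', v'} D]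
    (G : C ⥤ᵖ D) {p q : C} {f : p ⟶ q} (h : IsEquivalence₁ f) : IsEquivalence₁ (G.map f) := by
  obtain ⟨g, ⟨a⟩, ⟨b⟩⟩ := h
  exact ⟨G.map g, ⟨(G.mapComp f g).symm ≪≫ G.map₂Iso a ≪≫ G.mapId p⟩,
    ⟨(G.mapComp g f).symm ≪≫ G.map₂Iso b ≪≫ G.mapId q⟩⟩

/-- A locally constant stack on `X` with values in the 2-category `C`: a global section over `X` of
the constant 2-stack with stalk `C`, i.e. of the 2-stack associated with the constant 2-prestack.

The associated 2-stack is constructed by compatible germs, as for sheaves. The construction of the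
sheaf associated with the constant presheaf with value a set `S` takes as sections the families
`s x ∈ S` of stalks such that `s y = s x` for all `x` and all `y` near `x`. Two levels up, equality
becomes an equivalence, with coherences. A section consists of
* a stalk `obj x : C` for each point `x`;
* for each `x` and each `y` near `x`, an equivalence `tr : obj x ⟶ obj y` of stalks;
* for each `x`, each `y` near `x`, and each `z` near `y`, an invertible 2-arrow
  `trComp : tr x y ≫ tr y z ≅ tr x z`;
* such that for each `x`, `y` near `x`, `z` near `y`, `t` near `z` the usual cocycle condition of a
  descent datum for 2-stacks holds.
The predicates `dom₁`, `dom₂` record on which neighbourhoods the data are given. As the data matter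
only as germs, sections which agree after shrinking these domains are equivalent (the identities of
the stalks are then the components of an equivalence). As usual for descent data there is no unit
datum: it is determined by the rest, the 1-arrows `tr` being equivalences.

For `U` open in `X` the sections over `U` form a 2-prestack `U ↦ LocConstStack U C`. It is a
2-stack (descent data are glued by choosing, for each point, a member of the covering containing it;
only germs at the points matter), and the 2-functors `P ↦ const U P` into it are
locally essentially surjective (`locally_const`), locally essentially surjective on 1-arrows
(`locally_constHom`) and locally bijective on 2-arrows (`locally_constHom₂`). So it is the 2-stack
associated with the constant 2-prestack. No condition on the space `X` is needed. -/
structure LocConstStack (X : Type*) [TopologicalSpace X] (C : Type u) [Bicategory.{w, v} C] where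
  obj : X → C
  dom₁ : X → X → Prop
  eventually_dom₁ : ∀ x, ∀ᶠ y in 𝓝 x, dom₁ x y
  tr : ∀ {x y : X}, dom₁ x y → (obj x ⟶ obj y)
  tr_equivalence : ∀ {x y : X} (h : dom₁ x y), IsEquivalence₁ (tr h)
  dom₂ : X → X → X → Prop
  eventually_dom₂ : ∀ x, ∀ᶠ y in 𝓝 x, ∀ᶠ z in 𝓝 y, dom₂ x y z
  trComp : ∀ {x y z : X} (hxy : dom₁ x y) (hyz : dom₁ y z) (hxz : dom₁ x z),
    dom₂ x y z → (tr hxy ≫ tr hyz ≅ tr hxz)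
  trComp_assoc : ∀ x, ∀ᶠ y in 𝓝 x, ∀ᶠ z in 𝓝 y, ∀ᶠ t in 𝓝 z,
    ∀ (hxy : dom₁ x y) (hxz : dom₁ x z) (hxt : dom₁ x t) (hyz : dom₁ y z) (hyt : dom₁ y t)
      (hzt : dom₁ z t) (hxyz : dom₂ x y z) (hxyt : dom₂ x y t) (hxzt : dom₂ x z t)
      (hyzt : dom₂ y z t),
      (trComp hxy hyz hxz hxyz).hom ▷ tr hzt ≫ (trComp hxz hzt hxt hxzt).hom =
        (α_ (tr hxy) (tr hyz) (tr hzt)).hom ≫ tr hxy ◁ (trComp hyz hzt hyt hyzt).hom ≫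
          (trComp hxy hyt hxt hxyt).hom

namespace LocConstStack

variable {X : Type*} [TopologicalSpace X] {C : Type u} [Bicategory.{w, v} C]

/-- A 1-arrow between locally constant stacks: stalkwise 1-arrows which commute with the 1-arrows
`tr` up to invertible 2-arrows, given for each `x` and each `y` near `x`, and compatible with the
2-arrows `trComp` for each `x`, `y` near `x` and `z` near `y`. -/
structure Hom (P Q : LocConstStack X C) where
  app : ∀ x, P.obj x ⟶ Q.obj x
  dom : X → X → Prop
  eventually_dom : ∀ x, ∀ᶠ y in 𝓝 x, dom x y
  nat : ∀ {x y : X} (hP : P.dom₁ x y) (hQ : Q.dom₁ x y), dom x y →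
    (P.tr hP ≫ app y ≅ app x ≫ Q.tr hQ)
  nat_comp : ∀ x, ∀ᶠ y in 𝓝 x, ∀ᶠ z in 𝓝 y,
    ∀ (hPxy : P.dom₁ x y) (hPyz : P.dom₁ y z) (hPxz : P.dom₁ x z) (hP : P.dom₂ x y z)
      (hQxy : Q.dom₁ x y) (hQyz : Q.dom₁ y z) (hQxz : Q.dom₁ x z) (hQ : Q.dom₂ x y z)
      (hxy : dom x y) (hyz : dom y z) (hxz : dom x z),
      (P.trComp hPxy hPyz hPxz hP).hom ▷ app z ≫ (nat hPxz hQxz hxz).hom =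
        (α_ _ _ _).hom ≫ P.tr hPxy ◁ (nat hPyz hQyz hyz).hom ≫ (α_ _ _ _).inv ≫
          (nat hPxy hQxy hxy).hom ▷ Q.tr hQyz ≫ (α_ _ _ _).hom ≫
            app x ◁ (Q.trComp hQxy hQyz hQxz hQ).hom

/-- A 2-arrow: stalkwise 2-arrows compatible with the data of the two 1-arrows for each `x` and each
`y` near `x`. -/
structure Hom₂ {P Q : LocConstStack X C} (f g : Hom P Q) where
  app : ∀ x, f.app x ⟶ g.app x
  naturality : ∀ x, ∀ᶠ y in 𝓝 x,
    ∀ (hP : P.dom₁ x y) (hQ : Q.dom₁ x y) (hf : f.dom x y) (hg : g.dom x y),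
      P.tr hP ◁ app y ≫ (g.nat hP hQ hg).hom = (f.nat hP hQ hf).hom ≫ app x ▷ Q.tr hQ

theorem Hom₂.ext {P Q : LocConstStack X C} {f g : Hom P Q} {a b : Hom₂ f g}
    (h : ∀ x, a.app x = b.app x) : a = b := by
  cases a; cases b; congr; funext x; exact h x

theorem id_coh {p₀ p₁ p₂ : C} {a : p₀ ⟶ p₁} {b : p₁ ⟶ p₂} {c : p₀ ⟶ p₂} (φ : a ≫ b ⟶ c) :
    φ ▷ 𝟙 p₂ ≫ (ρ_ c).hom ≫ (λ_ c).inv =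
      (α_ _ _ _).hom ≫ a ◁ ((ρ_ b).hom ≫ (λ_ b).inv) ≫ (α_ _ _ _).inv ≫
        ((ρ_ a).hom ≫ (λ_ a).inv) ▷ b ≫ (α_ _ _ _).hom ≫ 𝟙 p₀ ◁ φ := by
  simp

theorem comp_coh {p₀ p₁ p₂ q₀ q₁ q₂ r₀ r₁ r₂ : C}
    {a : p₀ ⟶ p₁} {b : p₁ ⟶ p₂} {c : p₀ ⟶ p₂} {φ : a ≫ b ⟶ c}
    {a' : q₀ ⟶ q₁} {b' : q₁ ⟶ q₂} {c' : q₀ ⟶ q₂} {φ' : a' ≫ b' ⟶ c'}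
    {a'' : r₀ ⟶ r₁} {b'' : r₁ ⟶ r₂} {c'' : r₀ ⟶ r₂} {φ'' : a'' ≫ b'' ⟶ c''}
    {f₀ : p₀ ⟶ q₀} {f₁ : p₁ ⟶ q₁} {f₂ : p₂ ⟶ q₂}
    {g₀ : q₀ ⟶ r₀} {g₁ : q₁ ⟶ r₁} {g₂ : q₂ ⟶ r₂}
    {s : a ≫ f₁ ⟶ f₀ ≫ a'} {s' : b ≫ f₂ ⟶ f₁ ≫ b'} {s'' : c ≫ f₂ ⟶ f₀ ≫ c'}
    {t : a' ≫ g₁ ⟶ g₀ ≫ a''} {t' : b' ≫ g₂ ⟶ g₁ ≫ b''} {t'' : c' ≫ g₂ ⟶ g₀ ≫ c''}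
    (hs : φ ▷ f₂ ≫ s'' = (α_ _ _ _).hom ≫ a ◁ s' ≫ (α_ _ _ _).inv ≫ s ▷ b' ≫
      (α_ _ _ _).hom ≫ f₀ ◁ φ')
    (ht : φ' ▷ g₂ ≫ t'' = (α_ _ _ _).hom ≫ a' ◁ t' ≫ (α_ _ _ _).inv ≫ t ▷ b'' ≫
      (α_ _ _ _).hom ≫ g₀ ◁ φ'') :
    φ ▷ (f₂ ≫ g₂) ≫ (α_ _ _ _).inv ≫ s'' ▷ g₂ ≫ (α_ _ _ _).hom ≫ f₀ ◁ t'' ≫ (α_ _ _ _).inv =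
      (α_ _ _ _).hom ≫
        a ◁ ((α_ _ _ _).inv ≫ s' ▷ g₂ ≫ (α_ _ _ _).hom ≫ f₁ ◁ t' ≫ (α_ _ _ _).inv) ≫
          (α_ _ _ _).inv ≫
            ((α_ _ _ _).inv ≫ s ▷ g₁ ≫ (α_ _ _ _).hom ≫ f₀ ◁ t ≫ (α_ _ _ _).inv) ▷ b'' ≫
              (α_ _ _ _).hom ≫ (f₀ ≫ g₀) ◁ φ'' := by
  calc
    _ = (α_ _ _ _).inv ≫ (φ ▷ f₂ ≫ s'') ▷ g₂ ≫ (α_ _ _ _).hom ≫ f₀ ◁ t'' ≫ (α_ _ _ _).inv := by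
      simp
    _ = (α_ _ _ _).inv ≫ ((α_ _ _ _).hom ≫ a ◁ s' ≫ (α_ _ _ _).inv ≫ s ▷ b' ≫
      (α_ _ _ _).hom) ▷ g₂ ≫ (α_ _ _ _).hom ≫ f₀ ◁ (φ' ▷ g₂ ≫ t'') ≫ (α_ _ _ _).inv := by
      rw [hs]; simp
    _ = 𝟙 _ ⊗≫ a ◁ s' ▷ g₂ ⊗≫ (s ▷ (b' ≫ g₂) ≫ (f₀ ≫ a') ◁ t') ⊗≫ f₀ ◁ t ▷ b'' ⊗≫
        f₀ ◁ g₀ ◁ φ'' ⊗≫ 𝟙 _ := by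
      rw [ht]; bicategory
    _ = _ := by
      rw [← whisker_exchange]; bicategory


theorem whiskerLeft_coh {p₀ p₁ q₀ q₁ r₀ r₁ : C} {a : p₀ ⟶ p₁} {a' : q₀ ⟶ q₁} {a'' : r₀ ⟶ r₁}
    {f₀ : p₀ ⟶ q₀} {f₁ : p₁ ⟶ q₁} {g₀ h₀ : q₀ ⟶ r₀} {g₁ h₁ : q₁ ⟶ r₁}
    {s : a ≫ f₁ ⟶ f₀ ≫ a'} {t : a' ≫ g₁ ⟶ g₀ ≫ a''} {t' : a' ≫ h₁ ⟶ h₀ ≫ a''}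
    {m₀ : g₀ ⟶ h₀} {m₁ : g₁ ⟶ h₁} (hm : a' ◁ m₁ ≫ t' = t ≫ m₀ ▷ a'') :
    a ◁ (f₁ ◁ m₁) ≫ (α_ _ _ _).inv ≫ s ▷ h₁ ≫ (α_ _ _ _).hom ≫ f₀ ◁ t' ≫ (α_ _ _ _).inv =
      ((α_ _ _ _).inv ≫ s ▷ g₁ ≫ (α_ _ _ _).hom ≫ f₀ ◁ t ≫ (α_ _ _ _).inv) ≫
        (f₀ ◁ m₀) ▷ a'' := by
  calc
    _ = 𝟙 _ ⊗≫ ((a ≫ f₁) ◁ m₁ ≫ s ▷ h₁) ⊗≫ f₀ ◁ t' ⊗≫ 𝟙 _ := by bicategory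
    _ = 𝟙 _ ⊗≫ s ▷ g₁ ⊗≫ f₀ ◁ (a' ◁ m₁ ≫ t') ⊗≫ 𝟙 _ := by rw [whisker_exchange]; bicategory
    _ = _ := by rw [hm]; bicategory

theorem whiskerRight_coh {p₀ p₁ q₀ q₁ r₀ r₁ : C} {a : p₀ ⟶ p₁} {a' : q₀ ⟶ q₁} {a'' : r₀ ⟶ r₁}
    {f₀ g₀ : p₀ ⟶ q₀} {f₁ g₁ : p₁ ⟶ q₁} {h₀ : q₀ ⟶ r₀} {h₁ : q₁ ⟶ r₁}
    {s : a ≫ f₁ ⟶ f₀ ≫ a'} {s' : a ≫ g₁ ⟶ g₀ ≫ a'} {t : a' ≫ h₁ ⟶ h₀ ≫ a''}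
    {m₀ : f₀ ⟶ g₀} {m₁ : f₁ ⟶ g₁} (hm : a ◁ m₁ ≫ s' = s ≫ m₀ ▷ a') :
    a ◁ (m₁ ▷ h₁) ≫ (α_ _ _ _).inv ≫ s' ▷ h₁ ≫ (α_ _ _ _).hom ≫ g₀ ◁ t ≫ (α_ _ _ _).inv =
      ((α_ _ _ _).inv ≫ s ▷ h₁ ≫ (α_ _ _ _).hom ≫ f₀ ◁ t ≫ (α_ _ _ _).inv) ≫
        (m₀ ▷ h₀) ▷ a'' := by
  calc
    _ = 𝟙 _ ⊗≫ (a ◁ m₁ ≫ s') ▷ h₁ ⊗≫ g₀ ◁ t ⊗≫ 𝟙 _ := by bicategory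
    _ = 𝟙 _ ⊗≫ s ▷ h₁ ⊗≫ (m₀ ▷ (a' ≫ h₁) ≫ g₀ ◁ t) ⊗≫ 𝟙 _ := by rw [hm]; bicategory
    _ = _ := by rw [← whisker_exchange]; bicategory

theorem associator_coh {p₀ p₁ q₀ q₁ r₀ r₁ s₀ s₁ : C} {a : p₀ ⟶ p₁} {b : q₀ ⟶ q₁} {c : r₀ ⟶ r₁}
    {d : s₀ ⟶ s₁} {f₀ : p₀ ⟶ q₀} {f₁ : p₁ ⟶ q₁} {g₀ : q₀ ⟶ r₀} {g₁ : q₁ ⟶ r₁}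
    {h₀ : r₀ ⟶ s₀} {h₁ : r₁ ⟶ s₁}
    (k : a ≫ f₁ ⟶ f₀ ≫ b) (l : b ≫ g₁ ⟶ g₀ ≫ c) (m : c ≫ h₁ ⟶ h₀ ≫ d) :
    a ◁ (α_ f₁ g₁ h₁).hom ≫ (α_ _ _ _).inv ≫ k ▷ (g₁ ≫ h₁) ≫ (α_ _ _ _).hom ≫
        f₀ ◁ ((α_ _ _ _).inv ≫ l ▷ h₁ ≫ (α_ _ _ _).hom ≫ g₀ ◁ m ≫ (α_ _ _ _).inv) ≫
          (α_ _ _ _).inv =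
      ((α_ _ _ _).inv ≫ ((α_ _ _ _).inv ≫ k ▷ g₁ ≫ (α_ _ _ _).hom ≫ f₀ ◁ l ≫
        (α_ _ _ _).inv) ▷ h₁ ≫ (α_ _ _ _).hom ≫ (f₀ ≫ g₀) ◁ m ≫ (α_ _ _ _).inv) ≫
          (α_ f₀ g₀ h₀).hom ▷ d := by
  bicategory

theorem leftUnitor_coh {p₀ p₁ q₀ q₁ : C} {a : p₀ ⟶ p₁} {b : q₀ ⟶ q₁} {f₀ : p₀ ⟶ q₀}
    {f₁ : p₁ ⟶ q₁} (k : a ≫ f₁ ⟶ f₀ ≫ b) :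
    a ◁ (λ_ f₁).hom ≫ k =
      ((α_ _ _ _).inv ≫ ((ρ_ a).hom ≫ (λ_ a).inv) ▷ f₁ ≫ (α_ _ _ _).hom ≫ 𝟙 p₀ ◁ k ≫
        (α_ _ _ _).inv) ≫ (λ_ f₀).hom ▷ b := by
  simp

theorem rightUnitor_coh {p₀ p₁ q₀ q₁ : C} {a : p₀ ⟶ p₁} {b : q₀ ⟶ q₁} {f₀ : p₀ ⟶ q₀}
    {f₁ : p₁ ⟶ q₁} (k : a ≫ f₁ ⟶ f₀ ≫ b) :
    a ◁ (ρ_ f₁).hom ≫ k =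
      ((α_ _ _ _).inv ≫ k ▷ 𝟙 q₁ ≫ (α_ _ _ _).hom ≫ f₀ ◁ ((ρ_ b).hom ≫ (λ_ b).inv) ≫
        (α_ _ _ _).inv) ≫ (ρ_ f₀).hom ▷ b := by
  simp

theorem iso_coh {p₀ p₁ q₀ q₁ : C} {a : p₀ ⟶ p₁} {b : q₀ ⟶ q₁} {f₀ g₀ : p₀ ⟶ q₀}
    {f₁ g₁ : p₁ ⟶ q₁} {k : a ≫ f₁ ⟶ f₀ ≫ b} {l : a ≫ g₁ ⟶ g₀ ≫ b} (m₀ : f₀ ≅ g₀) (m₁ : f₁ ≅ g₁)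
    (h : a ◁ m₁.hom ≫ l = k ≫ m₀.hom ▷ b) : a ◁ m₁.inv ≫ k = l ≫ m₀.inv ▷ b := by
  rw [← cancel_mono (m₀.hom ▷ b), Category.assoc, ← h]
  simp

def Hom.id (P : LocConstStack X C) : Hom P P where
  app x := 𝟙 (P.obj x)
  dom _ _ := True
  eventually_dom _ := Eventually.of_forall fun _ => trivial
  nat hP _ _ := ρ_ (P.tr hP) ≪≫ (λ_ (P.tr hP)).symm
  nat_comp _ := Eventually.of_forall fun _ => Eventually.of_forall fun _ =>
    fun _ _ _ _ _ _ _ _ _ _ _ => id_coh _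

def Hom.comp {P Q R : LocConstStack X C} (f : Hom P Q) (g : Hom Q R) : Hom P R where
  app x := f.app x ≫ g.app x
  dom x y := Q.dom₁ x y ∧ f.dom x y ∧ g.dom x y
  eventually_dom x := (Q.eventually_dom₁ x).and ((f.eventually_dom x).and (g.eventually_dom x))
  nat hP hR h :=
    (α_ _ _ _).symm ≪≫ whiskerRightIso (f.nat hP h.1 h.2.1) _ ≪≫ α_ _ _ _ ≪≫
      whiskerLeftIso _ (g.nat h.1 hR h.2.2) ≪≫ (α_ _ _ _).symm
  nat_comp x := by
    filter_upwards [Q.eventually_dom₂ x, f.nat_comp x, g.nat_comp x] with y hQ hf hg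
    filter_upwards [hQ, hf, hg] with z hQ hf hg
    intro hPxy hPyz hPxz hP hRxy hRyz hRxz hR hxy hyz hxz
    exact comp_coh
      (hf hPxy hPyz hPxz hP hxy.1 hyz.1 hxz.1 hQ hxy.2.1 hyz.2.1 hxz.2.1)
      (hg hxy.1 hyz.1 hxz.1 hQ hRxy hRyz hRxz hR hxy.2.2 hyz.2.2 hxz.2.2)

instance : CategoryStruct (LocConstStack X C) where
  Hom := Hom
  id := Hom.id
  comp := Hom.comp

instance homCategory (P Q : LocConstStack X C) : Category (P ⟶ Q) where
  Hom f g := Hom₂ f g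
  id f := { app := fun x => 𝟙 (f.app x)
            naturality := fun _ => Eventually.of_forall fun _ => by simp }
  comp {f g h} m n :=
    { app := fun x => m.app x ≫ n.app x
      naturality := fun x => by
        filter_upwards [g.eventually_dom x, m.naturality x, n.naturality x] with y hg hm hn
        intro hP hQ hf hh
        rw [whiskerLeft_comp, Category.assoc, hn hP hQ hg hh, ← Category.assoc,
          hm hP hQ hf hg, Category.assoc, comp_whiskerRight] }
  id_comp _ := Hom₂.ext fun _ => Category.id_comp _
  comp_id _ := Hom₂.ext fun _ => Category.comp_id _
  assoc _ _ _ := Hom₂.ext fun _ => Category.assoc _ _ _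

/-- An invertible 2-arrow from invertible stalkwise 2-arrows. -/
def isoMk {P Q : LocConstStack X C} {f g : P ⟶ Q} (m : ∀ x, f.app x ≅ g.app x)
    (h : ∀ x, ∀ᶠ y in 𝓝 x, ∀ (hP : P.dom₁ x y) (hQ : Q.dom₁ x y) (hf : f.dom x y)
      (hg : g.dom x y),
      P.tr hP ◁ (m y).hom ≫ (g.nat hP hQ hg).hom = (f.nat hP hQ hf).hom ≫ (m x).hom ▷ Q.tr hQ) :
    f ≅ g where
  hom := { app := fun x => (m x).hom, naturality := h }
  inv :=
    { app := fun x => (m x).inv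
      naturality := fun x => (h x).mono fun y hy hP hQ hg hf =>
        iso_coh (m x) (m y) (hy hP hQ hf hg) }
  hom_inv_id := Hom₂.ext fun x => (m x).hom_inv_id
  inv_hom_id := Hom₂.ext fun x => (m x).inv_hom_id

def Hom₂.whiskerLeft {P Q R : LocConstStack X C} (f : P ⟶ Q) {g h : Q ⟶ R} (m : Hom₂ g h) :
    Hom₂ (f ≫ g) (f ≫ h) where
  app x := f.app x ◁ m.app x
  naturality x := (m.naturality x).mono fun _ H _ hR hg hh =>
    whiskerLeft_coh (H hg.1 hR hg.2.2 hh.2.2)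

def Hom₂.whiskerRight {P Q R : LocConstStack X C} {f g : P ⟶ Q} (m : Hom₂ f g) (h : Q ⟶ R) :
    Hom₂ (f ≫ h) (g ≫ h) where
  app x := m.app x ▷ h.app x
  naturality x := (m.naturality x).mono fun _ H hP _ hf hg =>
    whiskerRight_coh (H hP hf.1 hf.2.1 hg.2.1)

/-- The 2-category `Γ(X, C_X)` of locally constant stacks on `X` with values in `C`; all
operations are stalkwise. -/
instance : Bicategory (LocConstStack X C) where
  whiskerLeft f _ _ m := Hom₂.whiskerLeft f m
  whiskerRight m h := Hom₂.whiskerRight m h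
  associator f g h := isoMk (fun x => α_ (f.app x) (g.app x) (h.app x)) fun _ =>
    Eventually.of_forall fun _ _ _ _ _ => associator_coh _ _ _
  leftUnitor f := isoMk (fun x => λ_ (f.app x)) fun _ =>
    Eventually.of_forall fun _ _ _ _ _ => leftUnitor_coh _
  rightUnitor f := isoMk (fun x => ρ_ (f.app x)) fun _ =>
    Eventually.of_forall fun _ _ _ _ _ => rightUnitor_coh _
  whiskerLeft_id _ _ := Hom₂.ext fun _ => whiskerLeft_id _ _
  whiskerLeft_comp _ _ _ _ _ _ := Hom₂.ext fun _ => whiskerLeft_comp _ _ _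
  id_whiskerLeft _ := Hom₂.ext fun _ => id_whiskerLeft _
  comp_whiskerLeft _ _ _ _ _ := Hom₂.ext fun _ => comp_whiskerLeft _ _ _
  id_whiskerRight _ _ := Hom₂.ext fun _ => id_whiskerRight _ _
  comp_whiskerRight _ _ _ := Hom₂.ext fun _ => comp_whiskerRight _ _ _
  whiskerRight_id _ := Hom₂.ext fun _ => whiskerRight_id _
  whiskerRight_comp _ _ _ := Hom₂.ext fun _ => whiskerRight_comp _ _ _
  whisker_assoc _ _ _ _ _ := Hom₂.ext fun _ => whisker_assoc _ _ _
  whisker_exchange _ _ := Hom₂.ext fun _ => whisker_exchange _ _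
  pentagon _ _ _ _ := Hom₂.ext fun _ => pentagon _ _ _ _
  triangle _ _ := Hom₂.ext fun _ => triangle _ _

variable {Y : Type*} [TopologicalSpace Y] {D : Type u'} [Bicategory.{w', v'} D]

/-- The inverse image of a locally constant stack, with stalk at `x` the stalk at `f x`. -/
def pullbackObj (f : C(X, Y)) (P : LocConstStack Y C) : LocConstStack X C where
  obj x := P.obj (f x)
  dom₁ x y := P.dom₁ (f x) (f y)
  eventually_dom₁ x := (f.continuous.tendsto x).eventually (P.eventually_dom₁ (f x))
  tr h := P.tr h
  tr_equivalence h := P.tr_equivalence h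
  dom₂ x y z := P.dom₂ (f x) (f y) (f z)
  eventually_dom₂ x := ((f.continuous.tendsto x).eventually (P.eventually_dom₂ (f x))).mono
    fun y hy => (f.continuous.tendsto y).eventually hy
  trComp hxy hyz hxz h := P.trComp hxy hyz hxz h
  trComp_assoc x := ((f.continuous.tendsto x).eventually (P.trComp_assoc (f x))).mono
    fun y hy => ((f.continuous.tendsto y).eventually hy).mono
      fun z hz => (f.continuous.tendsto z).eventually hz

def pullbackHom (f : C(X, Y)) {P Q : LocConstStack Y C} (φ : P ⟶ Q) :
    pullbackObj f P ⟶ pullbackObj f Q where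
  app x := φ.app (f x)
  dom x y := φ.dom (f x) (f y)
  eventually_dom x := (f.continuous.tendsto x).eventually (φ.eventually_dom (f x))
  nat hP hQ h := φ.nat hP hQ h
  nat_comp x := ((f.continuous.tendsto x).eventually (φ.nat_comp (f x))).mono
    fun y hy => (f.continuous.tendsto y).eventually hy

def pullbackHom₂ (f : C(X, Y)) {P Q : LocConstStack Y C} {φ ψ : P ⟶ Q} (m : φ ⟶ ψ) :
    pullbackHom f φ ⟶ pullbackHom f ψ where
  app x := m.app (f x)
  naturality x := (f.continuous.tendsto x).eventually (m.naturality (f x))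

theorem strict_assoc_coh {p q r s : C} (a : p ⟶ q) (b : q ⟶ r) (c : r ⟶ s) :
    (α_ a b c).hom =
      𝟙 _ ≫ 𝟙 (a ≫ b) ▷ c ≫ (α_ a b c).hom ≫ a ◁ 𝟙 (b ≫ c) ≫ 𝟙 _ := by
  simp

theorem strict_left_coh {p q : C} (a : p ⟶ q) :
    (λ_ a).hom = 𝟙 _ ≫ 𝟙 (𝟙 p) ▷ a ≫ (λ_ a).hom := by
  simp

theorem strict_right_coh {p q : C} (a : p ⟶ q) :
    (ρ_ a).hom = 𝟙 _ ≫ a ◁ 𝟙 (𝟙 q) ≫ (ρ_ a).hom := by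
  simp

/-- The inverse image 2-functor `f⁻¹ : Γ(Y, C_Y) → Γ(X, C_X)` along a continuous map `f : X → Y`. -/
def pullback (f : C(X, Y)) (C : Type u) [Bicategory.{w, v} C] :
    LocConstStack Y C ⥤ᵖ LocConstStack X C where
  obj P := pullbackObj f P
  map φ := pullbackHom f φ
  map₂ m := pullbackHom₂ f m
  map₂_id _ := rfl
  map₂_comp _ _ := rfl
  mapId P := Iso.refl (𝟙 (pullbackObj f P))
  mapComp φ ψ := Iso.refl (pullbackHom f φ ≫ pullbackHom f ψ)
  map₂_whisker_left _ _ _ _ := Hom₂.ext fun _ =>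
    ((Category.id_comp _).trans (Category.comp_id _)).symm
  map₂_whisker_right _ _ := Hom₂.ext fun _ =>
    ((Category.id_comp _).trans (Category.comp_id _)).symm
  map₂_associator _ _ _ := Hom₂.ext fun _ => strict_assoc_coh _ _ _
  map₂_left_unitor _ := Hom₂.ext fun _ => strict_left_coh _
  map₂_right_unitor _ := Hom₂.ext fun _ => strict_right_coh _

theorem pullback_id : pullback (ContinuousMap.id X) C = Pseudofunctor.id _ := rfl

/-- Inverse images are strictly compatible with composition: `(g ∘ f)⁻¹ = f⁻¹ ∘ g⁻¹`. -/
theorem pullback_comp {Z : Type*} [TopologicalSpace Z] (f : C(X, Y)) (g : C(Y, Z)) :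
    pullback (g.comp f) C = (pullback g C).comp (pullback f C) := by
  unfold pullback Pseudofunctor.comp
  congr
  · funext P
    refine Iso.ext (Hom₂.ext fun x => ?_)
    exact (Category.id_comp _).symm
  · funext P Q R φ ψ
    refine Iso.ext (Hom₂.ext fun x => ?_)
    exact (Category.id_comp _).symm

theorem mapObj_coh (G : C ⥤ᵖ D) {p q r s : C} {a : p ⟶ q} {b : q ⟶ r} {c : r ⟶ s}
    {d : p ⟶ r} {e : q ⟶ s} {t : p ⟶ s} {φ : a ≫ b ⟶ d} {ψ : d ≫ c ⟶ t} {φ' : b ≫ c ⟶ e}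
    {ψ' : a ≫ e ⟶ t} (h : φ ▷ c ≫ ψ = (α_ _ _ _).hom ≫ a ◁ φ' ≫ ψ') :
    ((G.mapComp a b).inv ≫ G.map₂ φ) ▷ G.map c ≫ (G.mapComp d c).inv ≫ G.map₂ ψ =
      (α_ _ _ _).hom ≫ G.map a ◁ ((G.mapComp b c).inv ≫ G.map₂ φ') ≫
        (G.mapComp a e).inv ≫ G.map₂ ψ' := by
  have h' := congrArg G.map₂ h
  simp only [PrelaxFunctor.map₂_comp, Pseudofunctor.map₂_whisker_right,
    Pseudofunctor.map₂_associator, Pseudofunctor.map₂_whisker_left, Category.assoc,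
    cancel_epi, Iso.inv_hom_id_assoc] at h'
  rw [comp_whiskerRight, Category.assoc, h']
  simp

theorem map_associator_inv (G : C ⥤ᵖ D) {p q r s : C} (a : p ⟶ q) (b : q ⟶ r) (c : r ⟶ s) :
    G.map₂ (α_ a b c).inv = (G.mapComp a (b ≫ c)).hom ≫ G.map a ◁ (G.mapComp b c).hom ≫
      (α_ _ _ _).inv ≫ (G.mapComp a b).inv ▷ G.map c ≫ (G.mapComp (a ≫ b) c).inv := by
  have h : G.map₂ (α_ a b c).inv ≫ G.map₂ (α_ a b c).hom = 𝟙 _ := by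
    rw [← PrelaxFunctor.map₂_comp, Iso.inv_hom_id, PrelaxFunctor.map₂_id]
  rw [← cancel_mono (G.map₂ (α_ a b c).hom), h, G.map₂_associator]
  simp

theorem mapHom_coh (G : C ⥤ᵖ D) {p₀ p₁ p₂ q₀ q₁ q₂ : C}
    {a : p₀ ⟶ p₁} {b : p₁ ⟶ p₂} {c : p₀ ⟶ p₂} {φ : a ≫ b ⟶ c}
    {a' : q₀ ⟶ q₁} {b' : q₁ ⟶ q₂} {c' : q₀ ⟶ q₂} {φ' : a' ≫ b' ⟶ c'}
    {f₀ : p₀ ⟶ q₀} {f₁ : p₁ ⟶ q₁} {f₂ : p₂ ⟶ q₂}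
    {s : a ≫ f₁ ⟶ f₀ ≫ a'} {s' : b ≫ f₂ ⟶ f₁ ≫ b'} {s'' : c ≫ f₂ ⟶ f₀ ≫ c'}
    (hs : φ ▷ f₂ ≫ s'' = (α_ _ _ _).hom ≫ a ◁ s' ≫ (α_ _ _ _).inv ≫ s ▷ b' ≫
      (α_ _ _ _).hom ≫ f₀ ◁ φ') :
    ((G.mapComp a b).inv ≫ G.map₂ φ) ▷ G.map f₂ ≫
        (G.mapComp c f₂).inv ≫ G.map₂ s'' ≫ (G.mapComp f₀ c').hom =
      (α_ _ _ _).hom ≫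
        G.map a ◁ ((G.mapComp b f₂).inv ≫ G.map₂ s' ≫ (G.mapComp f₁ b').hom) ≫
          (α_ _ _ _).inv ≫
            ((G.mapComp a f₁).inv ≫ G.map₂ s ≫ (G.mapComp f₀ a').hom) ▷ G.map b' ≫
              (α_ _ _ _).hom ≫ G.map f₀ ◁ ((G.mapComp a' b').inv ≫ G.map₂ φ') := by
  have h' := congrArg G.map₂ hs
  simp only [PrelaxFunctor.map₂_comp, Pseudofunctor.map₂_whisker_right,
    Pseudofunctor.map₂_associator, Pseudofunctor.map₂_whisker_left, Category.assoc,
    cancel_epi, Iso.inv_hom_id_assoc, map_associator_inv] at h'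
  rw [comp_whiskerRight, Category.assoc, reassoc_of% h']
  simp


theorem mapHom₂_coh (G : C ⥤ᵖ D) {p₀ p₁ q₀ q₁ : C} {a : p₀ ⟶ p₁} {b : q₀ ⟶ q₁}
    {f₀ g₀ : p₀ ⟶ q₀} {f₁ g₁ : p₁ ⟶ q₁} {s : a ≫ f₁ ⟶ f₀ ≫ b} {t : a ≫ g₁ ⟶ g₀ ≫ b}
    {m₀ : f₀ ⟶ g₀} {m₁ : f₁ ⟶ g₁} (h : a ◁ m₁ ≫ t = s ≫ m₀ ▷ b) :
    G.map a ◁ G.map₂ m₁ ≫ (G.mapComp a g₁).inv ≫ G.map₂ t ≫ (G.mapComp g₀ b).hom =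
      ((G.mapComp a f₁).inv ≫ G.map₂ s ≫ (G.mapComp f₀ b).hom) ≫ G.map₂ m₀ ▷ G.map b := by
  have h' := congrArg G.map₂ h
  simp only [PrelaxFunctor.map₂_comp, Pseudofunctor.map₂_whisker_right,
    Pseudofunctor.map₂_whisker_left, Category.assoc] at h'
  rw [← cancel_epi (G.mapComp a f₁).hom, reassoc_of% h']
  simp

theorem mapId_coh (G : C ⥤ᵖ D) {p q : C} (a : p ⟶ q) :
    G.map a ◁ (G.mapId q).hom ≫ (ρ_ (G.map a)).hom ≫ (λ_ (G.map a)).inv =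
      ((G.mapComp a (𝟙 q)).inv ≫ G.map₂ ((ρ_ a).hom ≫ (λ_ a).inv) ≫ (G.mapComp (𝟙 p) a).hom) ≫
        (G.mapId p).hom ▷ G.map a := by
  have h : G.map₂ (λ_ a).inv ≫ G.map₂ (λ_ a).hom = 𝟙 _ := by
    rw [← PrelaxFunctor.map₂_comp, Iso.inv_hom_id, PrelaxFunctor.map₂_id]
  rw [G.map₂_left_unitor] at h
  rw [← cancel_mono (λ_ (G.map a)).hom]
  simp only [PrelaxFunctor.map₂_comp, Category.assoc, h, G.map₂_right_unitor,
    Iso.inv_hom_id_assoc, Iso.inv_hom_id, Category.comp_id]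

theorem mapComp_coh (G : C ⥤ᵖ D) {p₀ p₁ q₀ q₁ r₀ r₁ : C} {a : p₀ ⟶ p₁} {a' : q₀ ⟶ q₁}
    {a'' : r₀ ⟶ r₁} {f₀ : p₀ ⟶ q₀} {f₁ : p₁ ⟶ q₁} {g₀ : q₀ ⟶ r₀} {g₁ : q₁ ⟶ r₁}
    (s : a ≫ f₁ ⟶ f₀ ≫ a') (t : a' ≫ g₁ ⟶ g₀ ≫ a'') :
    G.map a ◁ (G.mapComp f₁ g₁).hom ≫ (α_ _ _ _).inv ≫
        ((G.mapComp a f₁).inv ≫ G.map₂ s ≫ (G.mapComp f₀ a').hom) ▷ G.map g₁ ≫ (α_ _ _ _).hom ≫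
          G.map f₀ ◁ ((G.mapComp a' g₁).inv ≫ G.map₂ t ≫ (G.mapComp g₀ a'').hom) ≫
            (α_ _ _ _).inv =
      ((G.mapComp a (f₁ ≫ g₁)).inv ≫
        G.map₂ ((α_ _ _ _).inv ≫ s ▷ g₁ ≫ (α_ _ _ _).hom ≫ f₀ ◁ t ≫ (α_ _ _ _).inv) ≫
          (G.mapComp (f₀ ≫ g₀) a'').hom) ≫ (G.mapComp f₀ g₀).hom ▷ G.map a'' := by
  simp only [PrelaxFunctor.map₂_comp, Pseudofunctor.map₂_whisker_right,
    Pseudofunctor.map₂_associator, Pseudofunctor.map₂_whisker_left, Category.assoc,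
    map_associator_inv, Iso.inv_hom_id_assoc, comp_whiskerRight, whiskerLeft_comp,
    inv_hom_whiskerRight, Category.comp_id]

def mapObj (G : C ⥤ᵖ D) (P : LocConstStack X C) : LocConstStack X D where
  obj x := G.obj (P.obj x)
  dom₁ := P.dom₁
  eventually_dom₁ := P.eventually_dom₁
  tr h := G.map (P.tr h)
  tr_equivalence h := (P.tr_equivalence h).map G
  dom₂ := P.dom₂
  eventually_dom₂ := P.eventually_dom₂
  trComp hxy hyz hxz h :=
    (G.mapComp (P.tr hxy) (P.tr hyz)).symm ≪≫ G.map₂Iso (P.trComp hxy hyz hxz h)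
  trComp_assoc x := by
    filter_upwards [P.trComp_assoc x] with y hy
    filter_upwards [hy] with z hz
    filter_upwards [hz] with t ht
    intro hxy hxz hxt hyz hyt hzt hxyz hxyt hxzt hyzt
    exact mapObj_coh G (ht hxy hxz hxt hyz hyt hzt hxyz hxyt hxzt hyzt)

def mapHom (G : C ⥤ᵖ D) {P Q : LocConstStack X C} (φ : P ⟶ Q) : mapObj G P ⟶ mapObj G Q where
  app x := G.map (φ.app x)
  dom := φ.dom
  eventually_dom := φ.eventually_dom
  nat {x y} hP hQ h := (G.mapComp (P.tr hP) (φ.app y)).symm ≪≫ G.map₂Iso (φ.nat hP hQ h) ≪≫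
    G.mapComp (φ.app x) (Q.tr hQ)
  nat_comp x := by
    filter_upwards [φ.nat_comp x] with y hy
    filter_upwards [hy] with z hz
    intro hPxy hPyz hPxz hP hQxy hQyz hQxz hQ hxy hyz hxz
    exact mapHom_coh G (hz hPxy hPyz hPxz hP hQxy hQyz hQxz hQ hxy hyz hxz)

def mapHom₂ (G : C ⥤ᵖ D) {P Q : LocConstStack X C} {φ ψ : P ⟶ Q} (m : φ ⟶ ψ) :
    mapHom G φ ⟶ mapHom G ψ where
  app x := G.map₂ (m.app x)
  naturality x := (m.naturality x).mono fun _ h hP hQ hf hg => mapHom₂_coh G (h hP hQ hf hg)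

/-- The 2-functor `Γ(X, C_X) → Γ(X, D_X)` induced by a 2-functor `G : C → D`. -/
def map (X : Type*) [TopologicalSpace X] (G : C ⥤ᵖ D) :
    LocConstStack X C ⥤ᵖ LocConstStack X D where
  obj P := mapObj G P
  map φ := mapHom G φ
  map₂ m := mapHom₂ G m
  map₂_id _ := Hom₂.ext fun _ => G.map₂_id _
  map₂_comp _ _ := Hom₂.ext fun _ => G.map₂_comp _ _
  mapId P := isoMk (f := mapHom G (𝟙 P)) (g := 𝟙 (mapObj G P)) (fun x => G.mapId (P.obj x))
    fun _ => Eventually.of_forall fun _ _ _ _ _ => mapId_coh G _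
  mapComp φ ψ := isoMk (f := mapHom G (φ ≫ ψ)) (g := mapHom G φ ≫ mapHom G ψ)
    (fun x => G.mapComp (φ.app x) (ψ.app x))
    fun _ => Eventually.of_forall fun _ _ _ _ _ => mapComp_coh G _ _
  map₂_whisker_left _ _ _ _ := Hom₂.ext fun _ => G.map₂_whisker_left _ _
  map₂_whisker_right _ _ := Hom₂.ext fun _ => G.map₂_whisker_right _ _
  map₂_associator _ _ _ := Hom₂.ext fun _ => G.map₂_associator _ _ _
  map₂_left_unitor _ := Hom₂.ext fun _ => G.map₂_left_unitor _
  map₂_right_unitor _ := Hom₂.ext fun _ => G.map₂_right_unitor _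


theorem mapTrans_coh {G G' : C ⥤ᵖ D} (σ : G ⟶ G') {p q r : C} {a : p ⟶ q} {b : q ⟶ r}
    {c : p ⟶ r} (φ : a ≫ b ⟶ c) :
    ((G.mapComp a b).inv ≫ G.map₂ φ) ▷ σ.app r ≫ (σ.naturality c).hom =
      (α_ _ _ _).hom ≫ G.map a ◁ (σ.naturality b).hom ≫ (α_ _ _ _).inv ≫
        (σ.naturality a).hom ▷ G'.map b ≫ (α_ _ _ _).hom ≫
          σ.app p ◁ ((G'.mapComp a b).inv ≫ G'.map₂ φ) := by
  rw [comp_whiskerRight, Category.assoc, Pseudofunctor.StrongTrans.naturality_naturality,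
    Pseudofunctor.StrongTrans.naturality_comp_hom]
  simp

def mapTransApp {G G' : C ⥤ᵖ D} (σ : G ⟶ G') (P : LocConstStack X C) :
    mapObj G P ⟶ mapObj G' P where
  app x := σ.app (P.obj x)
  dom _ _ := True
  eventually_dom _ := Eventually.of_forall fun _ => trivial
  nat hP _ _ := σ.naturality (P.tr hP)
  nat_comp _ := Eventually.of_forall fun _ => Eventually.of_forall fun _ =>
    fun _ _ _ _ _ _ _ _ _ _ _ => mapTrans_coh σ _

theorem mapTransNat_coh {G G' : C ⥤ᵖ D} (σ : G ⟶ G') {p₀ p₁ q₀ q₁ : C} {a : p₀ ⟶ p₁}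
    {b : q₀ ⟶ q₁} {f₀ : p₀ ⟶ q₀} {f₁ : p₁ ⟶ q₁} (s : a ≫ f₁ ⟶ f₀ ≫ b) :
    G.map a ◁ (σ.naturality f₁).hom ≫ (α_ _ _ _).inv ≫ (σ.naturality a).hom ▷ G'.map f₁ ≫
        (α_ _ _ _).hom ≫
          σ.app p₀ ◁ ((G'.mapComp a f₁).inv ≫ G'.map₂ s ≫ (G'.mapComp f₀ b).hom) ≫
            (α_ _ _ _).inv =
      ((α_ _ _ _).inv ≫
        ((G.mapComp a f₁).inv ≫ G.map₂ s ≫ (G.mapComp f₀ b).hom) ▷ σ.app q₁ ≫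
          (α_ _ _ _).hom ≫ G.map f₀ ◁ (σ.naturality b).hom ≫ (α_ _ _ _).inv) ≫
            (σ.naturality f₀).hom ▷ G'.map b := by
  have h := σ.naturality_naturality s
  rw [Pseudofunctor.StrongTrans.naturality_comp_hom,
    Pseudofunctor.StrongTrans.naturality_comp_hom] at h
  rw [← cancel_epi (α_ (G.map a) (G.map f₁) (σ.app q₁)).hom,
    ← cancel_epi ((G.mapComp a f₁).hom ▷ σ.app q₁),
    ← cancel_mono (α_ (σ.app p₀) (G'.map f₀) (G'.map b)).hom,
    ← cancel_mono (σ.app p₀ ◁ (G'.mapComp f₀ b).inv)]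
  simp only [Category.assoc, whiskerLeft_comp, comp_whiskerRight, Iso.inv_hom_id_assoc,
    Iso.hom_inv_id_assoc, whiskerLeft_hom_inv, hom_inv_whiskerRight_assoc, Category.comp_id] at h ⊢
  exact h.symm

/-- The 2-transformation induced by a 2-transformation `σ : G → G'` of 2-functors. -/
def mapTrans (X : Type*) [TopologicalSpace X] {G G' : C ⥤ᵖ D} (σ : G ⟶ G') :
    map X G ⟶ map X G' where
  app P := mapTransApp σ P
  naturality {P Q} φ := isoMk (f := mapHom G φ ≫ mapTransApp σ Q)
    (g := mapTransApp σ P ≫ mapHom G' φ) (fun x => σ.naturality (φ.app x))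
    fun _ => Eventually.of_forall fun _ _ _ _ _ => mapTransNat_coh σ _
  naturality_naturality _ := Hom₂.ext fun _ => σ.naturality_naturality _
  naturality_id _ := Hom₂.ext fun _ => σ.naturality_id _
  naturality_comp _ _ := Hom₂.ext fun _ => σ.naturality_comp _ _


theorem compare_coh {p₀ p₁ p₂ : C} {a : p₀ ⟶ p₁} {b : p₁ ⟶ p₂} {c : p₀ ⟶ p₂}
    {φ φ' : a ≫ b ⟶ c} (h : φ = φ') :
    φ ▷ 𝟙 p₂ ≫ (ρ_ c).hom ≫ (λ_ c).inv =
      (α_ _ _ _).hom ≫ a ◁ ((ρ_ b).hom ≫ (λ_ b).inv) ≫ (α_ _ _ _).inv ≫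
        ((ρ_ a).hom ≫ (λ_ a).inv) ▷ b ≫ (α_ _ _ _).hom ≫ 𝟙 p₀ ◁ φ' := by
  rw [h]; exact id_coh φ'

theorem compareNat_coh {p₀ p₁ q₀ q₁ : C} {a : p₀ ⟶ p₁} {b : q₀ ⟶ q₁} {f₀ : p₀ ⟶ q₀}
    {f₁ : p₁ ⟶ q₁} {s s' : a ≫ f₁ ⟶ f₀ ≫ b} (h : s = s') :
    a ◁ ((ρ_ f₁).hom ≫ (λ_ f₁).inv) ≫ (α_ _ _ _).inv ≫ ((ρ_ a).hom ≫ (λ_ a).inv) ▷ f₁ ≫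
        (α_ _ _ _).hom ≫ 𝟙 p₀ ◁ s' ≫ (α_ _ _ _).inv =
      ((α_ _ _ _).inv ≫ s ▷ 𝟙 q₁ ≫ (α_ _ _ _).hom ≫ f₀ ◁ ((ρ_ b).hom ≫ (λ_ b).inv) ≫
        (α_ _ _ _).inv) ≫ ((ρ_ f₀).hom ≫ (λ_ f₀).inv) ▷ b := by
  rw [h]; simp

def mapIdApp (P : LocConstStack X C) : mapObj (Pseudofunctor.id C) P ⟶ P where
  app x := 𝟙 (P.obj x)
  dom _ _ := True
  eventually_dom _ := Eventually.of_forall fun _ => trivial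
  nat hP _ _ := ρ_ (P.tr hP) ≪≫ (λ_ (P.tr hP)).symm
  nat_comp _ := Eventually.of_forall fun _ => Eventually.of_forall fun _ =>
    fun _ _ _ _ _ _ _ _ _ _ _ => compare_coh (Category.id_comp _)

/-- The comparison between the 2-functor induced by an identity and the identity; its components
are identities. -/
def mapIdTrans (X : Type*) [TopologicalSpace X] (C : Type u) [Bicategory.{w, v} C] :
    map X (Pseudofunctor.id C) ⟶ Pseudofunctor.id (LocConstStack X C) where
  app P := mapIdApp P
  naturality {P Q} φ := isoMk (f := mapHom (Pseudofunctor.id C) φ ≫ mapIdApp Q)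
    (g := mapIdApp P ≫ φ) (fun x => ρ_ (φ.app x) ≪≫ (λ_ (φ.app x)).symm)
    fun _ => Eventually.of_forall fun _ _ _ _ _ =>
      compareNat_coh ((Category.id_comp _).trans (Category.comp_id _))
  naturality_naturality m := Hom₂.ext fun x =>
    (Pseudofunctor.StrongTrans.id (Pseudofunctor.id C)).naturality_naturality (m.app x)
  naturality_id P := Hom₂.ext fun x =>
    (Pseudofunctor.StrongTrans.id (Pseudofunctor.id C)).naturality_id (P.obj x)
  naturality_comp φ ψ := Hom₂.ext fun x =>
    (Pseudofunctor.StrongTrans.id (Pseudofunctor.id C)).naturality_comp (φ.app x) (ψ.app x)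

variable {E : Type u''} [Bicategory.{w'', v''} E]

theorem mapCompObj_coh (G : C ⥤ᵖ D) (H : D ⥤ᵖ E) {p q r : C} {a : p ⟶ q} {b : q ⟶ r}
    {c : p ⟶ r} (φ : a ≫ b ⟶ c) :
    ((G.comp H).mapComp a b).inv ≫ (G.comp H).map₂ φ =
      (H.mapComp (G.map a) (G.map b)).inv ≫ H.map₂ ((G.mapComp a b).inv ≫ G.map₂ φ) := by
  rw [H.map₂_comp]
  exact Category.assoc _ _ _

theorem regroup {p q : C} {f₀ f₁ f₂ f₃ f₄ f₅ : p ⟶ q} (a : f₀ ⟶ f₁) (b : f₁ ⟶ f₂)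
    (c : f₂ ⟶ f₃) (d : f₃ ⟶ f₄) (e : f₄ ⟶ f₅) :
    (a ≫ b) ≫ c ≫ d ≫ e = a ≫ (b ≫ c ≫ d) ≫ e := by
  simp only [Category.assoc]

theorem mapCompHom_coh (G : C ⥤ᵖ D) (H : D ⥤ᵖ E) {p q r s : C} {a : p ⟶ q} {b : q ⟶ r}
    {c : p ⟶ s} {d : s ⟶ r} (φ : a ≫ b ⟶ c ≫ d) :
    ((G.comp H).mapComp a b).inv ≫ (G.comp H).map₂ φ ≫ ((G.comp H).mapComp c d).hom =
      (H.mapComp (G.map a) (G.map b)).inv ≫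
        H.map₂ ((G.mapComp a b).inv ≫ G.map₂ φ ≫ (G.mapComp c d).hom) ≫
          (H.mapComp (G.map c) (G.map d)).hom := by
  rw [H.map₂_comp, H.map₂_comp]
  exact regroup _ _ _ _ _

def mapCompApp (G : C ⥤ᵖ D) (H : D ⥤ᵖ E) (P : LocConstStack X C) :
    mapObj (G.comp H) P ⟶ mapObj H (mapObj G P) where
  app x := 𝟙 (H.obj (G.obj (P.obj x)))
  dom _ _ := True
  eventually_dom _ := Eventually.of_forall fun _ => trivial
  nat hP _ _ := ρ_ (H.map (G.map (P.tr hP))) ≪≫ (λ_ (H.map (G.map (P.tr hP)))).symm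
  nat_comp _ := Eventually.of_forall fun _ => Eventually.of_forall fun _ =>
    fun _ _ _ _ _ _ _ _ _ _ _ => compare_coh (mapCompObj_coh G H _)

/-- The comparison between the 2-functor induced by a composition and the composition of the induced
2-functors; its components are identities. -/
def mapCompTrans (X : Type*) [TopologicalSpace X] (G : C ⥤ᵖ D) (H : D ⥤ᵖ E) :
    map X (G.comp H) ⟶ (map X G).comp (map X H) where
  app P := mapCompApp G H P
  naturality {P Q} φ := isoMk (f := mapHom (G.comp H) φ ≫ mapCompApp G H Q)
    (g := mapCompApp G H P ≫ mapHom H (mapHom G φ))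
    (fun x => ρ_ (H.map (G.map (φ.app x))) ≪≫ (λ_ (H.map (G.map (φ.app x)))).symm)
    fun _ => Eventually.of_forall fun _ _ _ _ _ => compareNat_coh (mapCompHom_coh G H _)
  naturality_naturality m := Hom₂.ext fun x =>
    (Pseudofunctor.StrongTrans.id (G.comp H)).naturality_naturality (m.app x)
  naturality_id P := Hom₂.ext fun x =>
    (Pseudofunctor.StrongTrans.id (G.comp H)).naturality_id (P.obj x)
  naturality_comp φ ψ := Hom₂.ext fun x =>
    (Pseudofunctor.StrongTrans.id (G.comp H)).naturality_comp (φ.app x) (ψ.app x)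


/-- The constant stack with stalk `P`: the image of `P` under `C → Γ(X, C_X)`. -/
def const (X : Type*) [TopologicalSpace X] (P : C) : LocConstStack X C where
  obj _ := P
  dom₁ _ _ := True
  eventually_dom₁ _ := Eventually.of_forall fun _ => trivial
  tr _ := 𝟙 P
  tr_equivalence _ := ⟨𝟙 P, ⟨λ_ _⟩, ⟨λ_ _⟩⟩
  dom₂ _ _ _ := True
  eventually_dom₂ _ := Eventually.of_forall fun _ => Eventually.of_forall fun _ => trivial
  trComp _ _ _ _ := λ_ (𝟙 P)
  trComp_assoc _ := Eventually.of_forall fun _ => Eventually.of_forall fun _ =>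
    Eventually.of_forall fun _ _ _ _ _ _ _ _ _ _ _ => by simp [unitors_equal]

theorem loc_coh {p q r s : C} {a : p ⟶ q} {b : q ⟶ r} {c : p ⟶ r} {d : q ⟶ s} {e : r ⟶ s} {t : p ⟶ s}
    (k : a ≫ d ≅ t) (l : c ≫ e ≅ t) (m : a ≫ b ≅ c) (n : b ≫ e ≅ d)
    (h : m.hom ▷ e ≫ l.hom = (α_ _ _ _).hom ≫ a ◁ n.hom ≫ k.hom) :
   (λ_ (𝟙 p)).hom ▷ t ≫ (λ_ t).hom ≫ k.inv = (α_ _ _ _).hom ≫ 𝟙 p ◁ ((λ_ t).hom ≫ l.inv) ≫ (α_ _ _ _).inv ≫ ((λ_ c).hom ≫ m.inv) ▷ e ≫ (α_ _ _ _).hom ≫ a ◁ n.hom := by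
  have : k.inv = l.inv ≫ m.inv ▷ e ≫ (α_ _ _ _).hom ≫ a ◁ n.hom := by
    rw [← cancel_mono k.hom]
    simp [← h]
  rw [this]; bicategory

/-- Every section is, on a neighbourhood of each point, equivalent to a constant one. -/
theorem locally_const (S : LocConstStack X C) (x : X) :
    ∃ U : Set X, IsOpen U ∧ x ∈ U ∧
      ∃ φ : const U (S.obj x) ⟶ pullbackObj (⟨Subtype.val, continuous_subtype_val⟩ : C(U, X)) S,
        ∀ y, IsEquivalence₁ (φ.app y) := by
  have h3 : ∀ᶠ y in 𝓝 x, ∀ᶠ z in 𝓝 y, S.dom₁ x z := (S.eventually_dom₁ x).eventually_nhds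
  have h4 : ∀ᶠ y in 𝓝 x, ∀ᶠ z in 𝓝 y, ∀ᶠ t in 𝓝 z, S.dom₂ x z t :=
    (S.eventually_dom₂ x).eventually_nhds
  have h5 : ∀ᶠ y in 𝓝 x, ∀ᶠ z in 𝓝 y, ∀ᶠ t in 𝓝 z, S.dom₁ x t := h3.eventually_nhds
  obtain ⟨U, hU, hUo, hxU⟩ := eventually_nhds_iff.1
    ((S.eventually_dom₁ x).and ((S.eventually_dom₂ x).and (S.trComp_assoc x)))
  have key : ∀ y : U, Tendsto (Subtype.val : U → X) (𝓝 y) (𝓝 y.1) := fun y =>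
    continuous_subtype_val.tendsto y
  refine ⟨U, hUo, hxU, ⟨fun y => S.tr (hU y y.2).1, fun y z => S.dom₂ x y z,
    fun y => (key y).eventually (hU y y.2).2.1,
    fun {y z} hP hQ h => λ_ _ ≪≫ (S.trComp (hU y y.2).1 hQ (hU z z.2).1 h).symm, ?_⟩,
    fun y => S.tr_equivalence _⟩
  intro y
  filter_upwards [(key y).eventually (hU y y.2).2.2] with z hz
  filter_upwards [(key z).eventually hz] with t ht
  intro _ _ _ _ hyz hzt hyt hyzt hxyz hxzt hxyt
  have := ht (hU y y.2).1 (hU z z.2).1 (hU t t.2).1 hyz hyt hzt hxyz hxyt hxzt hyzt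
  exact loc_coh (S.trComp _ _ _ hxyt) (S.trComp _ _ _ hxzt) (S.trComp _ _ _ hxyz) (S.trComp _ _ _ hyzt) this


theorem constHom_coh {p q : C} (f : p ⟶ q) :
    (λ_ (𝟙 p)).hom ▷ f ≫ (λ_ f).hom ≫ (ρ_ f).inv =
      (α_ _ _ _).hom ≫ 𝟙 p ◁ ((λ_ f).hom ≫ (ρ_ f).inv) ≫ (α_ _ _ _).inv ≫
        ((λ_ f).hom ≫ (ρ_ f).inv) ▷ 𝟙 q ≫ (α_ _ _ _).hom ≫ f ◁ (λ_ (𝟙 q)).hom := by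
  bicategory

/-- The image of a 1-arrow `f` under `C → Γ(X, C_X)`. -/
def constHom (X : Type*) [TopologicalSpace X] {P Q : C} (f : P ⟶ Q) :
    const X P ⟶ const X Q where
  app _ := f
  dom _ _ := True
  eventually_dom _ := Eventually.of_forall fun _ => trivial
  nat _ _ _ := λ_ f ≪≫ (ρ_ f).symm
  nat_comp _ := Eventually.of_forall fun _ => Eventually.of_forall fun _ =>
    fun _ _ _ _ _ _ _ _ _ _ _ => constHom_coh f

theorem locallyConstHom_coh {p q : C} {f g h : p ⟶ q} (k : 𝟙 p ≫ g ⟶ f ≫ 𝟙 q)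
    (l : 𝟙 p ≫ h ≅ f ≫ 𝟙 q) (m : 𝟙 p ≫ h ⟶ g ≫ 𝟙 q)
    (H : (λ_ (𝟙 p)).hom ▷ h ≫ l.hom = (α_ _ _ _).hom ≫ 𝟙 p ◁ m ≫ (α_ _ _ _).inv ≫
      k ▷ 𝟙 q ≫ (α_ _ _ _).hom ≫ f ◁ (λ_ (𝟙 q)).hom) :
    𝟙 p ◁ ((λ_ h).inv ≫ l.hom ≫ (ρ_ f).hom) ≫ (λ_ f).hom ≫ (ρ_ f).inv =
      m ≫ ((λ_ g).inv ≫ k ≫ (ρ_ f).hom) ▷ 𝟙 q := by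
  calc
    _ = 𝟙 _ ⊗≫ l.hom ⊗≫ 𝟙 _ := by bicategory
    _ = 𝟙 _ ⊗≫ ((λ_ (𝟙 p)).hom ▷ h ≫ l.hom) ⊗≫ 𝟙 _ := by bicategory
    _ = _ := by rw [H]; bicategory

/-- Every 1-arrow between constant sections is locally isomorphic to a constant one. -/
theorem locally_constHom {P Q : C} (φ : const X P ⟶ const X Q) (x : X) :
    ∃ U : Set X, IsOpen U ∧ x ∈ U ∧ Nonempty
      (pullbackHom (⟨Subtype.val, continuous_subtype_val⟩ : C(U, X)) φ ≅ constHom U (φ.app x)) := by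
  obtain ⟨U, hU, hUo, hxU⟩ := eventually_nhds_iff.1 ((φ.eventually_dom x).and (φ.nat_comp x))
  refine ⟨U, hUo, hxU, ⟨isoMk
    (fun y => (λ_ _).symm ≪≫ φ.nat trivial trivial (hU y y.2).1 ≪≫ ρ_ _) fun y => ?_⟩⟩
  filter_upwards [(continuous_subtype_val.tendsto y).eventually (hU y y.2).2] with z hz
  intro _ _ hyz _
  exact locallyConstHom_coh (p := P) (q := Q)
    (φ.nat trivial trivial (hU y y.2).1).hom (φ.nat trivial trivial (hU z z.2).1)
    (φ.nat trivial trivial hyz).hom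
    (hz trivial trivial trivial trivial trivial trivial trivial trivial (hU y y.2).1 hyz
      (hU z z.2).1)

theorem constHom₂_coh {p q : C} {f g : p ⟶ q} {m n : f ⟶ g}
    (h : 𝟙 p ◁ m ≫ (λ_ g).hom ≫ (ρ_ g).inv = ((λ_ f).hom ≫ (ρ_ f).inv) ≫ n ▷ 𝟙 q) : m = n := by
  simpa using h

/-- Every 2-arrow between constant 1-arrows is locally constant. -/
theorem locally_constHom₂ {P Q : C} {f g : P ⟶ Q} (m : constHom X f ⟶ constHom X g) (x : X) :
    ∀ᶠ y in 𝓝 x, m.app y = m.app x := by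
  filter_upwards [m.naturality x] with y hy
  exact constHom₂_coh (hy trivial trivial trivial trivial)

theorem pseudofunctor_ext {F F' : C ⥤ᵖ D} (h : F.toPrelaxFunctor = F'.toPrelaxFunctor)
    (hId : ∀ p, HEq (F.mapId p) (F'.mapId p))
    (hComp : ∀ {p q r : C} (a : p ⟶ q) (b : q ⟶ r), HEq (F.mapComp a b) (F'.mapComp a b)) :
    F = F' := by
  cases F; cases F'; cases h
  congr
  · funext p; exact eq_of_heq (hId p)
  · funext p q r a b; exact eq_of_heq (hComp a b)

/-- The inverse image 2-functors commute strictly with the 2-functors induced by `G : C → D`, so that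
they form a 3-transformation from `C ↦ Γ(Y, C_Y)` to `C ↦ Γ(X, C_X)`. -/
theorem map_pullback (f : C(X, Y)) (G : C ⥤ᵖ D) :
    (map Y G).comp (pullback f D) = (pullback f C).comp (map X G) :=
  pseudofunctor_ext rfl
    (fun P => heq_of_eq <| Iso.ext <| Hom₂.ext fun x => by
      change (G.mapId (P.obj (f x))).hom ≫ 𝟙 _ = G.map₂ (𝟙 _) ≫ (G.mapId (P.obj (f x))).hom
      simp)
    (fun φ ψ => heq_of_eq <| Iso.ext <| Hom₂.ext fun x => by
      change (G.mapComp (φ.app (f x)) (ψ.app (f x))).hom ≫ 𝟙 _ =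
        G.map₂ (𝟙 _) ≫ (G.mapComp (φ.app (f x)) (ψ.app (f x))).hom
      simp)

/-- An equivalence between the 3-transformations `f⁻¹` and `g⁻¹` from `C ↦ Γ(Y, C_Y)` to
`C ↦ Γ(X, C_X)`, for two continuous maps `f g : X → Y`. It consists of
* for each 2-category `C`, an equivalence `equiv C` (an equivalence in the 2-category of 2-functors,
  2-transformations and modifications) between `f⁻¹` and `g⁻¹`;
* for each 2-functor `G : C → D`, an invertible modification `square G` between the two composites
  of `equiv` with the 2-functors induced by `G` (`square_naturality` is the modification axiom);
* such that `square G` is natural in `G` with respect to 2-transformations (`square_trans`), and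
  compatible with identities and composition of 2-functors (`square_id`, `square_comp`). -/
structure PullbackEquiv (f g : C(X, Y)) where
  equiv : ∀ (C : Type u) [Bicategory.{w, v} C], pullback f C ≌ pullback g C
  square : ∀ {C D : Type u} [Bicategory.{w, v} C] [Bicategory.{w, v} D] (G : C ⥤ᵖ D)
    (S : LocConstStack Y C),
    (map X G).map ((equiv C).hom.app S) ≅ (equiv D).hom.app ((map Y G).obj S)
  square_naturality : ∀ {C D : Type u} [Bicategory.{w, v} C] [Bicategory.{w, v} D] (G : C ⥤ᵖ D)
    {S T : LocConstStack Y C} (φ : S ⟶ T),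
    (map X G).map₂ ((equiv C).hom.naturality φ).hom ≫
        ((map X G).mapComp ((equiv C).hom.app S) ((pullback g C).map φ)).hom ≫
          (square G S).hom ▷ (map X G).map ((pullback g C).map φ) =
      ((map X G).mapComp ((pullback f C).map φ) ((equiv C).hom.app T)).hom ≫
        (map X G).map ((pullback f C).map φ) ◁ (square G T).hom ≫
          ((equiv D).hom.naturality ((map Y G).map φ)).hom
  square_trans : ∀ {C D : Type u} [Bicategory.{w, v} C] [Bicategory.{w, v} D] {G G' : C ⥤ᵖ D}
    (σ : G ⟶ G') (S : LocConstStack Y C),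
    ((mapTrans X σ).naturality ((equiv C).hom.app S)).hom ≫
        (mapTrans X σ).app ((pullback f C).obj S) ◁ (square G' S).hom =
      (square G S).hom ▷ (mapTrans X σ).app ((pullback g C).obj S) ≫
        ((equiv D).hom.naturality ((mapTrans Y σ).app S)).inv
  square_id : ∀ {C : Type u} [Bicategory.{w, v} C] (S : LocConstStack Y C),
    ((mapIdTrans X C).naturality ((equiv C).hom.app S)).hom =
      (square (Pseudofunctor.id C) S).hom ▷ (mapIdTrans X C).app ((pullback g C).obj S) ≫
        ((equiv C).hom.naturality ((mapIdTrans Y C).app S)).inv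
  square_comp : ∀ {C D E : Type u} [Bicategory.{w, v} C] [Bicategory.{w, v} D]
    [Bicategory.{w, v} E] (G : C ⥤ᵖ D) (H : D ⥤ᵖ E) (S : LocConstStack Y C),
    ((mapCompTrans X G H).naturality ((equiv C).hom.app S)).hom ≫
        (mapCompTrans X G H).app ((pullback f C).obj S) ◁
          ((map X H).map₂ (square G S).hom ≫ (square H ((map Y G).obj S)).hom) =
      (square (G.comp H) S).hom ▷ (mapCompTrans X G H).app ((pullback g C).obj S) ≫
        ((equiv E).hom.naturality ((mapCompTrans Y G H).app S)).inv


/-- The projection `p : X × I → X`. -/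
def proj (X : Type*) [TopologicalSpace X] : C(X × unitInterval, X) := ContinuousMap.fst

/-- The map `ι_t : X → X × I`, `x ↦ (x, t)`. -/
def slice (X : Type*) [TopologicalSpace X] (t : unitInterval) : C(X, X × unitInterval) :=
  (ContinuousMap.id X).prodMk (ContinuousMap.const X t)

end LocConstStack
end HigherMonodromy

open HigherMonodromy

namespace HigherMonodromy

/-! ### Cancellation of equivalences, and pasting of squares over triangles and tetrahedra. -/

section Bicategorical

variable {C : Type u} [Bicategory.{w, v} C]

/-! Since `p ∘ ι_t` is the identity of `X` and inverse images compose strictly, one of the two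
equivalences is the identity. The other compares `ι_t ∘ p`, `(x, s) ↦ (x, t)`, with the identity of
`X × I`; it is parallel transport along the segments `{x} × I`.

Its existence rests on one principle. For stacks `P`, `Q` on `X × I`, restriction to the slice at
`t` is essentially surjective on 1-arrows `P ⟶ Q` (`exists_hom_extension`), faithful on 2-arrows
(`hom₂_ext_slice`) and full on invertible 2-arrows (`exists_iso_slice`).

To prove it, one uses that the transports of stalks are equivalences. Hence the 2-arrows between two
given 1-arrows are the sections of a locally constant sheaf of sets (`HomOn.isLocalSystem`), and
1-arrows exist locally with any prescribed stalk (`HomOn.exists_local_hom`) and glue along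
compatible invertible 2-arrows (`HomOn.exists_glue`). Data on the slice at `r` are extended to open
sets whose nonempty fibres over `X` are intervals containing `r`. On such a set a section is
determined by its values on the slice, the fibres being connected (`IsSection.eq_of_isStar`). So
extensions to two such sets agree on the intersection, and it is enough that every point `(x, s)`
lies in one of them. This is seen by moving along the segment from `(x, r)` to `(x, s)` and
adjoining small tubes; the sets may shrink in the direction of `X`, so nothing is needed of `X`. For
1-arrows the argument is the same one level up: extensions are compared by the unique 2-arrows that
are prescribed on the slice, and uniqueness gives the cocycle condition.

The identity of `ι_t⁻¹ S` then extends to 1-arrows in both directions between `(ι_t ∘ p)⁻¹ S` and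
`S`. Their naturality 2-arrows, the unit, the counit and the squares for a 2-functor `G` are lifted
from the slice, where the transports are isomorphic to identities and the required 2-arrows can be
written down (`conj`, `compId`, `mapIsoId`). Every axiom is an equality of 2-arrows, so it may be
checked on the slice, where it is one of the lemmas `conj_*`. -/

theorem IsEquivalence₁.precomp {p q : C} {f : p ⟶ q} (h : IsEquivalence₁ f) (r : C) :
    (Bicategory.precomp r f).IsEquivalence := by
  obtain ⟨g, ⟨a⟩, ⟨b⟩⟩ := h
  exact (CategoryTheory.Equivalence.mk (Bicategory.precomp r f) (Bicategory.precomp r g)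
    ((leftUnitorNatIso q r).symm ≪≫ (precomposing q q r).mapIso b.symm ≪≫
      associatorNatIsoRight _ _ _)
    ((associatorNatIsoRight _ _ _).symm ≪≫ (precomposing p p r).mapIso a ≪≫
      leftUnitorNatIso p r)).isEquivalence_functor

theorem IsEquivalence₁.postcomp {p q : C} {f : p ⟶ q} (h : IsEquivalence₁ f) (r : C) :
    (Bicategory.postcomp r f).IsEquivalence := by
  obtain ⟨g, ⟨a⟩, ⟨b⟩⟩ := h
  exact (CategoryTheory.Equivalence.mk (Bicategory.postcomp r f) (Bicategory.postcomp r g)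
    ((rightUnitorNatIso r p).symm ≪≫ (postcomposing r p p).mapIso a.symm ≪≫
      (associatorNatIsoLeft _ _ _).symm)
    (associatorNatIsoLeft _ _ _ ≪≫ (postcomposing r q q).mapIso b ≪≫
      rightUnitorNatIso r q)).isEquivalence_functor

/-- Fullness and faithfulness of `precomp`. Injectivity lets a transport of stalks be cancelled from
an equation; surjectivity solves an equation for the 2-arrow behind it. -/
theorem IsEquivalence₁.whiskerLeft_bijective {p q r : C} {f : p ⟶ q} (h : IsEquivalence₁ f)
    (g g' : q ⟶ r) : Function.Bijective fun m : g ⟶ g' => f ◁ m :=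
  haveI := h.precomp r
  ⟨(Bicategory.precomp r f).map_injective, (Bicategory.precomp r f).map_surjective⟩

theorem IsEquivalence₁.whiskerRight_bijective {p q r : C} {f : p ⟶ q} (h : IsEquivalence₁ f)
    (g g' : r ⟶ p) : Function.Bijective fun m : g ⟶ g' => m ▷ f :=
  haveI := h.postcomp r
  ⟨(Bicategory.postcomp r f).map_injective, (Bicategory.postcomp r f).map_surjective⟩

theorem IsEquivalence₁.exists_whiskerLeftIso {p q r : C} {f : p ⟶ q} (h : IsEquivalence₁ f)
    {g g' : q ⟶ r} (m : f ≫ g ≅ f ≫ g') : ∃ n : g ≅ g', f ◁ n.hom = m.hom :=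
  haveI := h.precomp r
  ⟨(Bicategory.precomp r f).preimageIso m, (Bicategory.precomp r f).map_preimage m.hom⟩

section Square

variable {p₀ p₁ q₀ q₁ : C} {a : p₀ ⟶ p₁} {b : q₀ ⟶ q₁} {f₀ g₀ : p₀ ⟶ q₀} {f₁ g₁ : p₁ ⟶ q₁}

/-- The equation is that of `Hom₂.naturality`. Together with `square_exists'` and `square_unique` it
says that this equation is the graph of a bijection between the 2-arrows at the two ends. -/
theorem square_exists (ha : IsEquivalence₁ a) (s : a ≫ f₁ ≅ f₀ ≫ b) (t : a ≫ g₁ ≅ g₀ ≫ b)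
    (m₀ : f₀ ⟶ g₀) : ∃ m₁ : f₁ ⟶ g₁, a ◁ m₁ ≫ t.hom = s.hom ≫ m₀ ▷ b := by
  obtain ⟨m₁, h⟩ := (ha.whiskerLeft_bijective f₁ g₁).2 (s.hom ≫ m₀ ▷ b ≫ t.inv)
  exact ⟨m₁, by simp [show a ◁ m₁ = _ from h]⟩

theorem square_exists' (hb : IsEquivalence₁ b) (s : a ≫ f₁ ≅ f₀ ≫ b) (t : a ≫ g₁ ≅ g₀ ≫ b)
    (m₁ : f₁ ⟶ g₁) : ∃ m₀ : f₀ ⟶ g₀, a ◁ m₁ ≫ t.hom = s.hom ≫ m₀ ▷ b := by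
  obtain ⟨m₀, h⟩ := (hb.whiskerRight_bijective f₀ g₀).2 (s.inv ≫ a ◁ m₁ ≫ t.hom)
  exact ⟨m₀, by simp [show m₀ ▷ b = _ from h]⟩

theorem square_unique (ha : IsEquivalence₁ a) (hb : IsEquivalence₁ b) {s : a ≫ f₁ ≅ f₀ ≫ b}
    {t : a ≫ g₁ ≅ g₀ ≫ b} {m₀ n₀ : f₀ ⟶ g₀} {m₁ n₁ : f₁ ⟶ g₁}
    (hm : a ◁ m₁ ≫ t.hom = s.hom ≫ m₀ ▷ b) (hn : a ◁ n₁ ≫ t.hom = s.hom ≫ n₀ ▷ b) :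
    m₀ = n₀ ↔ m₁ = n₁ := by
  constructor
  · rintro rfl
    exact (ha.whiskerLeft_bijective f₁ g₁).1 ((cancel_mono t.hom).1 (hm.trans hn.symm))
  · rintro rfl
    exact (hb.whiskerRight_bijective f₀ g₀).1 ((cancel_epi s.hom).1 (hm.symm.trans hn))

end Square

/-- A prism over the triangle `a`, `b`, `c`: compatibility along the two edges from the first vertex
forces it along the third, because `a` is an equivalence and can be cancelled. It shows that a
2-arrow spread out from a centre is compatible between any two nearby points. -/
theorem square_triangle {p₀ p₁ p₂ q₀ q₁ q₂ : C}
    {a : p₀ ⟶ p₁} {b : p₁ ⟶ p₂} {c : p₀ ⟶ p₂} {φ : a ≫ b ⟶ c}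
    {a' : q₀ ⟶ q₁} {b' : q₁ ⟶ q₂} {c' : q₀ ⟶ q₂} {φ' : a' ≫ b' ≅ c'}
    {f₀ g₀ : p₀ ⟶ q₀} {f₁ g₁ : p₁ ⟶ q₁} {f₂ g₂ : p₂ ⟶ q₂}
    {s : a ≫ f₁ ≅ f₀ ≫ a'} {s' : b ≫ f₂ ≅ f₁ ≫ b'} {s'' : c ≫ f₂ ≅ f₀ ≫ c'}
    {t : a ≫ g₁ ≅ g₀ ≫ a'} {t' : b ≫ g₂ ≅ g₁ ≫ b'} {t'' : c ≫ g₂ ≅ g₀ ≫ c'}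
    {m₀ : f₀ ⟶ g₀} {m₁ : f₁ ⟶ g₁} {m₂ : f₂ ⟶ g₂} (ha : IsEquivalence₁ a)
    (hs : φ ▷ f₂ ≫ s''.hom = (α_ _ _ _).hom ≫ a ◁ s'.hom ≫ (α_ _ _ _).inv ≫ s.hom ▷ b' ≫
      (α_ _ _ _).hom ≫ f₀ ◁ φ'.hom)
    (ht : φ ▷ g₂ ≫ t''.hom = (α_ _ _ _).hom ≫ a ◁ t'.hom ≫ (α_ _ _ _).inv ≫ t.hom ▷ b' ≫
      (α_ _ _ _).hom ≫ g₀ ◁ φ'.hom)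
    (h₁ : a ◁ m₁ ≫ t.hom = s.hom ≫ m₀ ▷ a') (h₂ : c ◁ m₂ ≫ t''.hom = s''.hom ≫ m₀ ▷ c') :
    b ◁ m₂ ≫ t'.hom = s'.hom ≫ m₁ ▷ b' := by
  refine (ha.whiskerLeft_bijective _ _).1 ?_
  dsimp only
  rw [← cancel_epi (α_ _ _ _).hom, ← cancel_mono (α_ _ _ _).inv, ← cancel_mono (t.hom ▷ b'),
    ← cancel_mono (α_ _ _ _).hom, ← cancel_mono (g₀ ◁ φ'.hom)]
  calc
    _ = (a ≫ b) ◁ m₂ ≫ ((α_ _ _ _).hom ≫ a ◁ t'.hom ≫ (α_ _ _ _).inv ≫ t.hom ▷ b' ≫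
      (α_ _ _ _).hom ≫ g₀ ◁ φ'.hom) := by simp
    _ = φ ▷ f₂ ≫ (c ◁ m₂ ≫ t''.hom) := by rw [← ht, whisker_exchange_assoc]
    _ = ((α_ _ _ _).hom ≫ a ◁ s'.hom ≫ (α_ _ _ _).inv ≫ s.hom ▷ b' ≫
      (α_ _ _ _).hom) ≫ (f₀ ◁ φ'.hom ≫ m₀ ▷ c') := by
        rw [h₂, reassoc_of% hs]; simp only [Category.assoc]
    _ = (α_ _ _ _).hom ≫ a ◁ s'.hom ≫ (α_ _ _ _).inv ≫ (s.hom ≫ m₀ ▷ a') ▷ b' ≫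
      (α_ _ _ _).hom ≫ g₀ ◁ φ'.hom := by
        rw [whisker_exchange]; simp
    _ = _ := by rw [← h₁]; simp

/-- Three faces of a tetrahedron determine the fourth: the two cocycle conditions paste the faces at
the vertex 0 into the face 123 preceded by `x₀₁`, which is then cancelled. It gives `nat_comp` for
1-arrows constructed from a centre. -/
theorem nat_tetrahedron {p₀ p₁ p₂ p₃ q₀ q₁ q₂ q₃ : C}
    {x₀₁ : p₀ ⟶ p₁} {x₀₂ : p₀ ⟶ p₂} {x₀₃ : p₀ ⟶ p₃} {x₁₂ : p₁ ⟶ p₂} {x₁₃ : p₁ ⟶ p₃}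
    {x₂₃ : p₂ ⟶ p₃}
    {y₀₁ : q₀ ⟶ q₁} {y₀₂ : q₀ ⟶ q₂} {y₀₃ : q₀ ⟶ q₃} {y₁₂ : q₁ ⟶ q₂} {y₁₃ : q₁ ⟶ q₃}
    {y₂₃ : q₂ ⟶ q₃}
    {φ₀₁₂ : x₀₁ ≫ x₁₂ ≅ x₀₂} {φ₀₁₃ : x₀₁ ≫ x₁₃ ≅ x₀₃} {φ₀₂₃ : x₀₂ ≫ x₂₃ ≅ x₀₃}
    {φ₁₂₃ : x₁₂ ≫ x₂₃ ≅ x₁₃}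
    {ψ₀₁₂ : y₀₁ ≫ y₁₂ ≅ y₀₂} {ψ₀₁₃ : y₀₁ ≫ y₁₃ ≅ y₀₃} {ψ₀₂₃ : y₀₂ ≫ y₂₃ ≅ y₀₃}
    {ψ₁₂₃ : y₁₂ ≫ y₂₃ ≅ y₁₃}
    {f₀ : p₀ ⟶ q₀} {f₁ : p₁ ⟶ q₁} {f₂ : p₂ ⟶ q₂} {f₃ : p₃ ⟶ q₃}
    {s₀₁ : x₀₁ ≫ f₁ ≅ f₀ ≫ y₀₁} {s₀₂ : x₀₂ ≫ f₂ ≅ f₀ ≫ y₀₂} {s₀₃ : x₀₃ ≫ f₃ ≅ f₀ ≫ y₀₃}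
    {s₁₂ : x₁₂ ≫ f₂ ≅ f₁ ≫ y₁₂} {s₁₃ : x₁₃ ≫ f₃ ≅ f₁ ≫ y₁₃} {s₂₃ : x₂₃ ≫ f₃ ≅ f₂ ≫ y₂₃}
    (hx : IsEquivalence₁ x₀₁)
    (hφ : φ₀₁₂.hom ▷ x₂₃ ≫ φ₀₂₃.hom = (α_ _ _ _).hom ≫ x₀₁ ◁ φ₁₂₃.hom ≫ φ₀₁₃.hom)
    (hψ : ψ₀₁₂.hom ▷ y₂₃ ≫ ψ₀₂₃.hom = (α_ _ _ _).hom ≫ y₀₁ ◁ ψ₁₂₃.hom ≫ ψ₀₁₃.hom)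
    (h₀₁₂ : φ₀₁₂.hom ▷ f₂ ≫ s₀₂.hom = (α_ _ _ _).hom ≫ x₀₁ ◁ s₁₂.hom ≫ (α_ _ _ _).inv ≫
      s₀₁.hom ▷ y₁₂ ≫ (α_ _ _ _).hom ≫ f₀ ◁ ψ₀₁₂.hom)
    (h₀₁₃ : φ₀₁₃.hom ▷ f₃ ≫ s₀₃.hom = (α_ _ _ _).hom ≫ x₀₁ ◁ s₁₃.hom ≫ (α_ _ _ _).inv ≫
      s₀₁.hom ▷ y₁₃ ≫ (α_ _ _ _).hom ≫ f₀ ◁ ψ₀₁₃.hom)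
    (h₀₂₃ : φ₀₂₃.hom ▷ f₃ ≫ s₀₃.hom = (α_ _ _ _).hom ≫ x₀₂ ◁ s₂₃.hom ≫ (α_ _ _ _).inv ≫
      s₀₂.hom ▷ y₂₃ ≫ (α_ _ _ _).hom ≫ f₀ ◁ ψ₀₂₃.hom) :
    φ₁₂₃.hom ▷ f₃ ≫ s₁₃.hom = (α_ _ _ _).hom ≫ x₁₂ ◁ s₂₃.hom ≫ (α_ _ _ _).inv ≫
      s₁₂.hom ▷ y₂₃ ≫ (α_ _ _ _).hom ≫ f₁ ◁ ψ₁₂₃.hom := by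
  refine (hx.whiskerLeft_bijective _ _).1 ?_
  dsimp only
  rw [← cancel_mono (α_ _ _ _).inv, ← cancel_mono (s₀₁.hom ▷ y₁₃), ← cancel_mono (α_ _ _ _).hom,
    ← cancel_mono (f₀ ◁ ψ₀₁₃.hom)]
  calc
    _ = 𝟙 _ ⊗≫ (x₀₁ ◁ φ₁₂₃.hom) ▷ f₃ ⊗≫ ((α_ _ _ _).hom ≫ x₀₁ ◁ s₁₃.hom ≫ (α_ _ _ _).inv ≫
      s₀₁.hom ▷ y₁₃ ≫ (α_ _ _ _).hom ≫ f₀ ◁ ψ₀₁₃.hom) := by bicategory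
    _ = 𝟙 _ ⊗≫ ((α_ _ _ _).hom ≫ x₀₁ ◁ φ₁₂₃.hom ≫ φ₀₁₃.hom) ▷ f₃ ⊗≫ s₀₃.hom := by
        rw [← h₀₁₃]; bicategory
    _ = 𝟙 _ ⊗≫ φ₀₁₂.hom ▷ x₂₃ ▷ f₃ ⊗≫ (φ₀₂₃.hom ▷ f₃ ≫ s₀₃.hom) := by
        rw [← hφ]; bicategory
    _ = 𝟙 _ ⊗≫ (φ₀₁₂.hom ▷ (x₂₃ ≫ f₃) ≫ x₀₂ ◁ s₂₃.hom) ⊗≫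
      s₀₂.hom ▷ y₂₃ ⊗≫ f₀ ◁ ψ₀₂₃.hom := by
        rw [h₀₂₃]; bicategory
    _ = 𝟙 _ ⊗≫ (x₀₁ ≫ x₁₂) ◁ s₂₃.hom ⊗≫ (φ₀₁₂.hom ▷ f₂ ≫ s₀₂.hom) ▷ y₂₃ ⊗≫
      f₀ ◁ ψ₀₂₃.hom := by
        rw [← whisker_exchange]; bicategory
    _ = 𝟙 _ ⊗≫ (x₀₁ ≫ x₁₂) ◁ s₂₃.hom ⊗≫ x₀₁ ◁ s₁₂.hom ▷ y₂₃ ⊗≫ s₀₁.hom ▷ y₁₂ ▷ y₂₃ ⊗≫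
      f₀ ◁ (ψ₀₁₂.hom ▷ y₂₃ ≫ ψ₀₂₃.hom) := by
        rw [h₀₁₂]; bicategory
    _ = 𝟙 _ ⊗≫ (x₀₁ ≫ x₁₂) ◁ s₂₃.hom ⊗≫ x₀₁ ◁ s₁₂.hom ▷ y₂₃ ⊗≫
      (s₀₁.hom ▷ (y₁₂ ≫ y₂₃) ≫ (f₀ ≫ y₀₁) ◁ ψ₁₂₃.hom) ⊗≫ f₀ ◁ ψ₀₁₃.hom := by
        rw [hψ]; bicategory
    _ = _ := by rw [← whisker_exchange]; bicategory

/-- In the equation of `nat_comp` everything except `s'` is invertible, so the equation prescribes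
`a ◁ s'`. -/
theorem exists_nat {p₀ p₁ p₂ q₀ q₁ q₂ : C}
    {a : p₀ ⟶ p₁} {b : p₁ ⟶ p₂} {c : p₀ ⟶ p₂} (φ : a ≫ b ≅ c)
    {a' : q₀ ⟶ q₁} {b' : q₁ ⟶ q₂} {c' : q₀ ⟶ q₂} (φ' : a' ≫ b' ≅ c')
    {f₀ : p₀ ⟶ q₀} {f₁ : p₁ ⟶ q₁} {f₂ : p₂ ⟶ q₂}
    (s : a ≫ f₁ ≅ f₀ ≫ a') (s'' : c ≫ f₂ ≅ f₀ ≫ c') (ha : IsEquivalence₁ a) :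
    ∃ s' : b ≫ f₂ ≅ f₁ ≫ b', φ.hom ▷ f₂ ≫ s''.hom = (α_ _ _ _).hom ≫ a ◁ s'.hom ≫
      (α_ _ _ _).inv ≫ s.hom ▷ b' ≫ (α_ _ _ _).hom ≫ f₀ ◁ φ'.hom := by
  obtain ⟨s', h⟩ := ha.exists_whiskerLeftIso ((α_ _ _ _).symm ≪≫ whiskerRightIso φ f₂ ≪≫ s'' ≪≫
    whiskerLeftIso f₀ φ'.symm ≪≫ (α_ _ _ _).symm ≪≫ whiskerRightIso s.symm b' ≪≫ α_ _ _ _)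
  exact ⟨s', by rw [h]; simp⟩

/-- The equation of `nat_comp` for a 1-arrow glued from local ones, with changes of chart inserted:
`hm` is the naturality of one change of chart, `hk` the cocycle condition for three charts. -/
theorem nat_comp_glue {p₀ p₁ p₂ q₀ q₁ q₂ : C}
    {a : p₀ ⟶ p₁} {b : p₁ ⟶ p₂} {c : p₀ ⟶ p₂} {φ : a ≫ b ⟶ c}
    {a' : q₀ ⟶ q₁} {b' : q₁ ⟶ q₂} {c' : q₀ ⟶ q₂} {φ' : a' ≫ b' ⟶ c'}
    {f₀ : p₀ ⟶ q₀} {f₁ g₁ : p₁ ⟶ q₁} {f₂ g₂ h₂ : p₂ ⟶ q₂}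
    {s : a ≫ f₁ ⟶ f₀ ≫ a'} {s' : b ≫ f₂ ⟶ f₁ ≫ b'} {s'' : c ≫ f₂ ⟶ f₀ ≫ c'}
    {t' : b ≫ g₂ ⟶ g₁ ≫ b'} {m₁ : g₁ ⟶ f₁} {m₂ : g₂ ⟶ f₂} {n₂ : h₂ ⟶ g₂} {k₂ : h₂ ⟶ f₂}
    (hs : φ ▷ f₂ ≫ s'' = (α_ _ _ _).hom ≫ a ◁ s' ≫ (α_ _ _ _).inv ≫ s ▷ b' ≫
      (α_ _ _ _).hom ≫ f₀ ◁ φ')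
    (hm : b ◁ m₂ ≫ s' = t' ≫ m₁ ▷ b') (hk : n₂ ≫ m₂ = k₂) :
    φ ▷ h₂ ≫ c ◁ k₂ ≫ s'' = (α_ _ _ _).hom ≫ a ◁ (b ◁ n₂ ≫ t') ≫ (α_ _ _ _).inv ≫
      (a ◁ m₁ ≫ s) ▷ b' ≫ (α_ _ _ _).hom ≫ f₀ ◁ φ' := by
  calc
    _ = (a ≫ b) ◁ k₂ ≫ (φ ▷ f₂ ≫ s'') := by rw [whisker_exchange_assoc]
    _ = 𝟙 _ ⊗≫ a ◁ b ◁ n₂ ⊗≫ a ◁ (b ◁ m₂ ≫ s') ⊗≫ s ▷ b' ⊗≫ f₀ ◁ φ' := by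
        rw [hs, ← hk]; bicategory
    _ = _ := by rw [hm]; bicategory

end Bicategorical

/-! ### Open sets that are star-shaped along the interval. -/

section Star

/-- Induction along a segment of the unit interval. -/
theorem uIcc_induction {r s : unitInterval} (p : unitInterval → Prop) (hr : p r)
    (h : ∀ q ∈ Set.uIcc r s, ∀ᶠ q' in 𝓝 q, q' ∈ Set.uIcc r s → (p q ↔ p q')) : p s := by
  refine (_root_.IsPreconnected.induction₂' isPreconnected_uIcc (fun a b => p a ↔ p b) ?_ ?_
    Set.left_mem_uIcc Set.right_mem_uIcc).1 hr
  · intro q hq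
    rw [eventually_nhdsWithin_iff]
    filter_upwards [h q hq] with q' hq' hm
    exact ⟨hq' hm, (hq' hm).symm⟩
  · intro a b c _ _ _ hab hbc
    exact hab.trans hbc

variable {X : Type*} {r : unitInterval}

/-- A subset of `X × I` whose fibres over `X` are star-shaped with respect to `r`. -/
def IsStar (r : unitInterval) (V : Set (X × unitInterval)) : Prop :=
  ∀ a ∈ V, ∀ s ∈ Set.uIcc r a.2, (a.1, s) ∈ V

theorem IsStar.base {V : Set (X × unitInterval)} (h : IsStar r V) {a : X × unitInterval}
    (ha : a ∈ V) : (a.1, r) ∈ V :=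
  h a ha r Set.left_mem_uIcc

theorem IsStar.inter {V W : Set (X × unitInterval)} (hV : IsStar r V) (hW : IsStar r W) :
    IsStar r (V ∩ W) :=
  fun a ha s hs => ⟨hV a ha.1 s hs, hW a ha.2 s hs⟩

theorem isStar_prod {U : Set X} {N : Set unitInterval} (hN : N.OrdConnected) (hr : r ∈ N) :
    IsStar r (U ×ˢ N) :=
  fun _ ha _ hs => ⟨ha.1, hN.uIcc_subset hr ha.2 hs⟩

/-- In dimension one star-shaped sets are intervals, so the centre may be moved to any level `q`
which the fibres contain. -/
theorem IsStar.inter_prod {V : Set (X × unitInterval)} (h : IsStar r V) {U : Set X}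
    {N : Set unitInterval} (hN : N.OrdConnected) {q : unitInterval} (hq : q ∈ N)
    (hU : ∀ y ∈ U, (y, q) ∈ V) : IsStar q (V ∩ U ×ˢ N) := by
  intro a ha s hs
  refine ⟨?_, ha.2.1, hN.uIcc_subset hq ha.2.2 hs⟩
  rcases Set.uIcc_subset_uIcc_union_uIcc (b := r) hs with h' | h'
  · exact h (a.1, q) (hU _ ha.2.1) s (by rwa [Set.uIcc_comm])
  · exact h a ha.1 s h'

/-- Enlargement by a tube. Restricting `V` to the fibres over `U`, all of which reach the level `q`,
keeps the union star-shaped: a point of the tube is joined to `r` through `(y, q)`. -/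
theorem IsStar.union_prod {V : Set (X × unitInterval)} (h : IsStar r V) {U : Set X}
    {N : Set unitInterval} (hN : N.OrdConnected) {q : unitInterval} (hq : q ∈ N)
    (hU : ∀ y ∈ U, (y, q) ∈ V) : IsStar r (V ∩ U ×ˢ Set.univ ∪ U ×ˢ N) := by
  rintro a (ha | ha) s hs
  · exact Or.inl ⟨h a ha.1 s hs, ha.2.1, trivial⟩
  · rcases Set.uIcc_subset_uIcc_union_uIcc (b := q) hs with h' | h'
    · exact Or.inl ⟨h (a.1, q) (hU _ ha.1) s h', ha.1, trivial⟩
    · exact Or.inr ⟨ha.1, hN.uIcc_subset hq ha.2 h'⟩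

theorem exists_tube [TopologicalSpace X] {V : Set (X × unitInterval)} {x : X} {q : unitInterval}
    (h : V ∈ 𝓝 (x, q)) : ∃ (U : Set X) (N : Set unitInterval), IsOpen U ∧ x ∈ U ∧ IsOpen N ∧
      q ∈ N ∧ N.OrdConnected ∧ U ×ˢ N ⊆ V := by
  obtain ⟨U, hU, N, hN, hV⟩ := mem_nhds_prod_iff.1 h
  obtain ⟨U', hU'U, hU', hx⟩ := mem_nhds_iff.1 hU
  obtain ⟨e, he, heN⟩ := Metric.mem_nhds_iff.1 hN
  refine ⟨U', Metric.ball q e, hU', hx, Metric.isOpen_ball, Metric.mem_ball_self he, ?_,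
    (Set.prod_mono hU'U heN).trans hV⟩
  have : Metric.ball q e = Subtype.val ⁻¹' Metric.ball (q : ℝ) e := rfl
  rw [this, Real.ball_eq_Ioo]
  exact Set.ordConnected_Ioo.preimage_mono fun _ _ h => h

end Star

/-! ### Locally constant sheaves of sets on subsets of the product with the interval. -/

section LocalSystem

/-- A section over `W` of a family of sets `F a` with local comparison relations `T a b`. -/
def IsSection {Z : Type*} [TopologicalSpace Z] {F : Z → Type*} (T : ∀ a b, F a → F b → Prop)
    (W : Set Z) (m : ∀ a ∈ W, F a) : Prop :=
  ∀ a (ha : a ∈ W), ∀ᶠ b in 𝓝 a, ∀ hb : b ∈ W, T a b (m a ha) (m b hb)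

theorem IsSection.mono {Z : Type*} [TopologicalSpace Z] {F : Z → Type*}
    {T : ∀ a b, F a → F b → Prop} {V W : Set Z} {m : ∀ a ∈ W, F a} (h : IsSection T W m)
    (hVW : V ⊆ W) : IsSection T V fun a ha => m a (hVW ha) :=
  fun a ha => (h a (hVW ha)).mono fun _ hb hbV => hb (hVW hbV)

/-- The comparison relations `T a b` are locally graphs of bijections which compose, so that they
define a locally constant sheaf of sets on `W`. -/
structure IsLocalSystem {Z : Type*} [TopologicalSpace Z] {F : Z → Type*}
    (T : ∀ a b, F a → F b → Prop) (W : Set Z) : Prop where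
  unique : ∀ a ∈ W, ∀ᶠ b in 𝓝 a, b ∈ W → ∀ u u' v v', T a b u v → T a b u' v' → (u = u' ↔ v = v')
  exists_section : ∀ a ∈ W, ∃ V, IsOpen V ∧ a ∈ V ∧ V ⊆ W ∧
    ∀ b (hb : b ∈ V) (v : F b), ∃ m, IsSection T V m ∧ m b hb = v

/-- Two sections agree on a set which is open and closed; this is the local form of that fact. -/
theorem IsSection.eventually_eq_iff {Z : Type*} [TopologicalSpace Z] {F : Z → Type*}
    {T : ∀ a b, F a → F b → Prop} {W V V' : Set Z} (hT : IsLocalSystem T W)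
    {m : ∀ a ∈ V, F a} {n : ∀ a ∈ V', F a} (hm : IsSection T V m) (hn : IsSection T V' n)
    (hV : V ⊆ W) {a : Z} (ha : a ∈ V) (ha' : a ∈ V') :
    ∀ᶠ b in 𝓝 a, ∀ (hb : b ∈ V) (hb' : b ∈ V'), m a ha = n a ha' ↔ m b hb = n b hb' := by
  filter_upwards [hT.unique a (hV ha), hm a ha, hn a ha'] with b hu hmb hnb hb hb'
  exact hu (hV hb) _ _ _ _ (hmb hb) (hnb hb')

/-- A member of the cover is chosen at each point. Near a point its member still applies, and
agreement on overlaps makes the choice irrelevant. -/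
theorem exists_section_glue {Z : Type*} [TopologicalSpace Z] {F : Z → Type*}
    {T : ∀ a b, F a → F b → Prop} {ι : Type*} {V : ι → Set Z} (hV : ∀ i, IsOpen (V i))
    {m : ∀ i, ∀ a ∈ V i, F a} (hm : ∀ i, IsSection T (V i) (m i))
    (h : ∀ i j a (hi : a ∈ V i) (hj : a ∈ V j), m i a hi = m j a hj)
    {W : Set Z} (hW : ∀ a ∈ W, ∃ i, a ∈ V i) :
    ∃ n, IsSection T W n ∧ ∀ i a (ha : a ∈ W) (hi : a ∈ V i), n a ha = m i a hi := by
  choose i hi using hW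
  refine ⟨fun a ha => m (i a ha) a (hi a ha), fun a ha => ?_, fun j a ha hj => h _ _ _ _ _⟩
  filter_upwards [hm _ a (hi a ha), (hV _).mem_nhds (hi a ha)] with b hb hbV hbW
  rw [h (i b hbW) (i a ha) b _ hbV]
  exact hb hbV

variable {X : Type*} [TopologicalSpace X] {r : unitInterval} {F : X × unitInterval → Type*}
  {T : ∀ a b, F a → F b → Prop}

/-- Along the segment from `(x, r)` to `(x, s)`, which stays in `V`, the truth of the equality is
locally constant. -/
theorem IsSection.eq_of_isStar {W V : Set (X × unitInterval)} (hT : IsLocalSystem T W)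
    {m n : ∀ a ∈ V, F a} (hm : IsSection T V m) (hn : IsSection T V n) (hV : V ⊆ W)
    (hr : IsStar r V) (h : ∀ y (hy : (y, r) ∈ V), m (y, r) hy = n (y, r) hy) :
    ∀ a ha, m a ha = n a ha := by
  rintro ⟨x, s⟩ ha
  refine uIcc_induction (r := r) (s := s)
    (fun q => ∀ hq : (x, q) ∈ V, m (x, q) hq = n (x, q) hq) (h x) (fun q hq => ?_) ha
  have hqV := hr _ ha q hq
  have hc : Tendsto (fun q' : unitInterval => (x, q')) (𝓝 q) (𝓝 (x, q)) :=
    (Continuous.prodMk_right x).tendsto q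
  filter_upwards [hc.eventually (hm.eventually_eq_iff hT hn hV hqV hqV)]
    with q' hq' hs
  have hq'V := hr _ ha q' hs
  exact ⟨fun H _ => (hq' hq'V hq'V).1 (H hqV), fun H _ => (hq' hq'V hq'V).2 (H hq'V)⟩

/-- A section over the slice at `r` extends to a star-shaped open set. -/
theorem IsLocalSystem.exists_extension {W : Set (X × unitInterval)} (hT : IsLocalSystem T W)
    (hr : IsStar r W) (m₀ : ∀ y, (y, r) ∈ W → F (y, r))
    (hm₀ : ∀ y (hy : (y, r) ∈ W), ∀ᶠ y' in 𝓝 y, ∀ hy' : (y', r) ∈ W,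
      T (y, r) (y', r) (m₀ y hy) (m₀ y' hy')) :
    ∃ m, IsSection T W m ∧ ∀ y hy, m (y, r) hy = m₀ y hy := by
  -- The agreement with `m₀` is part of the condition, so that any two such extensions coincide on
  -- the overlap by `IsSection.eq_of_isStar`.
  let Ext (V : Set (X × unitInterval)) : Prop := IsOpen V ∧ IsStar r V ∧ ∃ hV : V ⊆ W, ∃ m,
    IsSection T V m ∧ ∀ y hy, m (y, r) hy = m₀ y (hV hy)
  have key : ∀ a ∈ W, ∃ V, a ∈ V ∧ Ext V := by
    rintro ⟨x, s⟩ ha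
    refine uIcc_induction (r := r) (s := s) (fun q => ∃ V, (x, q) ∈ V ∧ Ext V) ?_ ?_
    · have hxr := hr.base ha
      obtain ⟨V, hVo, hxV, hVW, hV⟩ := hT.exists_section _ hxr
      obtain ⟨m, hm, hmx⟩ := hV _ hxV (m₀ x hxr)
      have hc : Tendsto (fun y : X => (y, r)) (𝓝 x) (𝓝 (x, r)) :=
        (Continuous.prodMk_left r).tendsto x
      have he : ∀ᶠ y in 𝓝 x, ∀ hy : (y, r) ∈ V, m (y, r) hy = m₀ y (hVW hy) := by
        filter_upwards [hc.eventually (hT.unique _ hxr), hc.eventually (hm _ hxV), hm₀ x hxr]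
          with y h₁ h₂ h₃ hy
        exact (h₁ (hVW hy) _ _ _ _ (h₂ hy) (h₃ (hVW hy))).1 hmx
      obtain ⟨U', hU', hU'o, hxU'⟩ := eventually_nhds_iff.1 he
      obtain ⟨U, N, hU, hxU, hN, hrN, hNc, hUN⟩ := exists_tube (hVo.mem_nhds hxV)
      have hs : (U ∩ U') ×ˢ N ⊆ V := (Set.prod_mono Set.inter_subset_left subset_rfl).trans hUN
      exact ⟨(U ∩ U') ×ˢ N, ⟨⟨hxU, hxU'⟩, hrN⟩, (hU.inter hU'o).prod hN, isStar_prod hNc hrN,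
        hs.trans hVW, _, hm.mono hs, fun y hy => hU' y hy.1.2 _⟩
    · intro q hq
      obtain ⟨V, hVo, hxV, hVW, hV⟩ := hT.exists_section _ (hr _ ha q hq)
      obtain ⟨U, N, hU, hxU, hN, hqN, hNc, hUN⟩ := exists_tube (hVo.mem_nhds hxV)
      -- Within one tube all levels are equally reachable: the section over the tube with the right
      -- value at `(x, q₁)` is glued to the extension obtained so far.
      have step : ∀ q₁ ∈ N, ∀ q₂ ∈ N, (∃ V, (x, q₁) ∈ V ∧ Ext V) →
          ∃ V, (x, q₂) ∈ V ∧ Ext V := by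
        rintro q₁ hq₁ q₂ hq₂ ⟨V₁, hx₁, hV₁o, hV₁r, hV₁W, m₁, hm₁, hmr⟩
        have hx₁V : (x, q₁) ∈ V := hUN ⟨hxU, hq₁⟩
        obtain ⟨m, hm, hmx⟩ := hV _ hx₁V (m₁ _ hx₁)
        have hc : Tendsto (fun y : X => (y, q₁)) (𝓝 x) (𝓝 (x, q₁)) :=
          (Continuous.prodMk_left q₁).tendsto x
        obtain ⟨U', hU', hU'o, hxU'⟩ := eventually_nhds_iff.1
          ((hc.eventually (hm₁.eventually_eq_iff hT hm hV₁W hx₁ hx₁V)).and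
            (hc.eventually (hV₁o.mem_nhds hx₁)))
        have hUs : ∀ y ∈ U ∩ U', (y, q₁) ∈ V₁ := fun y hy => (hU' y hy.2).2
        have hs : (U ∩ U') ×ˢ N ⊆ V :=
          (Set.prod_mono Set.inter_subset_left subset_rfl).trans hUN
        have hUo : IsOpen ((U ∩ U') ×ˢ N) := (hU.inter hU'o).prod hN
        have hUo' : IsOpen ((U ∩ U') ×ˢ (Set.univ : Set unitInterval)) :=
          (hU.inter hU'o).prod isOpen_univ
        -- On the overlap the centre is moved to `q₁`, since the two sections are only known to
        -- agree on that slice.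
        have heq := (hm₁.mono Set.inter_subset_left).eq_of_isStar hT
          (hm.mono (Set.inter_subset_right.trans hs)) (Set.inter_subset_left.trans hV₁W)
          (hV₁r.inter_prod hNc hq₁ hUs) fun y hy => ((hU' y hy.2.1.2).1 _ _).1 hmx.symm
        let V' : Bool → Set (X × unitInterval) := fun i => i.rec ((U ∩ U') ×ˢ N)
          (V₁ ∩ (U ∩ U') ×ˢ Set.univ)
        let m' : ∀ i, ∀ a ∈ V' i, F a := fun i => i.rec (fun a ha => m a (hs ha))
          (fun a ha => m₁ a ha.1)
        obtain ⟨n, hn, hnm⟩ := exists_section_glue (T := T) (V := V') (m := m')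
          (W := V₁ ∩ (U ∩ U') ×ˢ Set.univ ∪ (U ∩ U') ×ˢ N)
          (by rintro (_ | _); exacts [hUo, hV₁o.inter hUo'])
          (by rintro (_ | _); exacts [hm.mono hs, hm₁.mono Set.inter_subset_left])
          (by
            rintro (_ | _) (_ | _) a hi hj
            · rfl
            · exact (heq a ⟨hj.1, hi⟩).symm
            · exact heq a ⟨hi.1, hj⟩
            · rfl)
          (by rintro a (ha | ha); exacts [⟨true, ha⟩, ⟨false, ha⟩])
        refine ⟨_, Or.inr ⟨⟨hxU, hxU'⟩, hq₂⟩, (hV₁o.inter hUo').union hUo,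
          hV₁r.union_prod hNc hq₁ hUs, Set.union_subset (Set.inter_subset_left.trans hV₁W)
            (hs.trans hVW), n, hn, fun y hy => ?_⟩
        have hyU : y ∈ U ∩ U' := by
          rcases hy with hy | hy
          exacts [hy.2.1, hy.1]
        have hyr : (y, r) ∈ V₁ := hV₁r.base (hUs y hyU)
        exact (hnm true (y, r) hy ⟨hyr, hyU, trivial⟩).trans (hmr y hyr)
      filter_upwards [hN.mem_nhds hqN] with q' hq' _
      exact ⟨step q hqN q' hq', step q' hq' q hqN⟩
  choose V hV hVo hVr hVW m hm hmr using fun a : W => key a a.2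
  obtain ⟨n, hn, hnm⟩ := exists_section_glue hVo hm (fun i j a hi hj =>
    ((hm i).mono Set.inter_subset_left).eq_of_isStar hT
      ((hm j).mono Set.inter_subset_right) (Set.inter_subset_left.trans (hVW i))
      ((hVr i).inter (hVr j))
      (fun y hy => (hmr i y hy.1).trans (hmr j y hy.2).symm) a ⟨hi, hj⟩)
    (W := W) fun a ha => ⟨⟨a, ha⟩, hV ⟨a, ha⟩⟩
  exact ⟨n, hn, fun y hy => (hnm ⟨_, hy⟩ _ hy (hV ⟨_, hy⟩)).trans (hmr ⟨_, hy⟩ y _)⟩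

end LocalSystem

namespace LocConstStack

/-! ### 1-arrows over subsets: their 2-arrows, local existence and gluing. -/

section HomOn

variable {Z : Type*} [TopologicalSpace Z] {C : Type u} [Bicategory.{w, v} C]

/-- A 1-arrow between the restrictions of two locally constant stacks to a subset `W`. -/
structure HomOn (W : Set Z) (P Q : LocConstStack Z C) where
  app : ∀ a, a ∈ W → (P.obj a ⟶ Q.obj a)
  dom : Z → Z → Prop
  eventually_dom : ∀ a ∈ W, ∀ᶠ b in 𝓝 a, dom a b
  nat : ∀ {a b : Z} (ha : a ∈ W) (hb : b ∈ W) (hP : P.dom₁ a b) (hQ : Q.dom₁ a b), dom a b →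
    (P.tr hP ≫ app b hb ≅ app a ha ≫ Q.tr hQ)
  nat_comp : ∀ a ∈ W, ∀ᶠ b in 𝓝 a, ∀ᶠ c in 𝓝 b, ∀ (ha : a ∈ W) (hb : b ∈ W) (hc : c ∈ W)
    (hPab : P.dom₁ a b) (hPbc : P.dom₁ b c) (hPac : P.dom₁ a c) (hP : P.dom₂ a b c)
    (hQab : Q.dom₁ a b) (hQbc : Q.dom₁ b c) (hQac : Q.dom₁ a c) (hQ : Q.dom₂ a b c)
    (hab : dom a b) (hbc : dom b c) (hac : dom a c),
    (P.trComp hPab hPbc hPac hP).hom ▷ app c hc ≫ (nat ha hc hPac hQac hac).hom =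
      (α_ _ _ _).hom ≫ P.tr hPab ◁ (nat hb hc hPbc hQbc hbc).hom ≫ (α_ _ _ _).inv ≫
        (nat ha hb hPab hQab hab).hom ▷ Q.tr hQbc ≫ (α_ _ _ _).hom ≫
          app a ha ◁ (Q.trComp hQab hQbc hQac hQ).hom

namespace HomOn

variable {P Q : LocConstStack Z C} {V V' V'' W : Set Z}

/-- The restriction of a 1-arrow to a smaller subset. -/
def restrict (f : HomOn V P Q) (h : W ⊆ V) : HomOn W P Q where
  app a ha := f.app a (h ha)
  dom := f.dom
  eventually_dom a ha := f.eventually_dom a (h ha)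
  nat ha hb hP hQ hd := f.nat (h ha) (h hb) hP hQ hd
  nat_comp a ha := by
    filter_upwards [f.nat_comp a (h ha)] with b hb
    filter_upwards [hb] with c hc
    intro ha hb hc'
    exact hc (h ha) (h hb) (h hc')

/-- A 1-arrow of sections, as a 1-arrow over the whole space. -/
def ofHom (f : P ⟶ Q) : HomOn Set.univ P Q where
  app a _ := f.app a
  dom := f.dom
  eventually_dom a _ := f.eventually_dom a
  nat _ _ hP hQ hd := f.nat hP hQ hd
  nat_comp a _ := by
    filter_upwards [f.nat_comp a] with b hb
    filter_upwards [hb] with c hc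
    intro _ _ _
    exact hc

/-- A 1-arrow over the whole space, as a 1-arrow of sections. -/
def toHom (f : HomOn Set.univ P Q) : P ⟶ Q where
  app a := f.app a trivial
  dom := f.dom
  eventually_dom a := f.eventually_dom a trivial
  nat hP hQ hd := f.nat trivial trivial hP hQ hd
  nat_comp a := by
    filter_upwards [f.nat_comp a trivial] with b hb
    filter_upwards [hb] with c hc
    exact hc trivial trivial trivial

/-- Compatibility of two 2-arrows between the stalks of `f` and `g` with the structure of
`f` and `g`. -/
def Rel (f : HomOn V P Q) (g : HomOn V' P Q) (a b : Z)
    (u : ∀ (h : a ∈ V) (h' : a ∈ V'), f.app a h ⟶ g.app a h')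
    (v : ∀ (h : b ∈ V) (h' : b ∈ V'), f.app b h ⟶ g.app b h') : Prop :=
  ∀ (ha : a ∈ V) (ha' : a ∈ V') (hb : b ∈ V) (hb' : b ∈ V') (hP : P.dom₁ a b) (hQ : Q.dom₁ a b)
    (hf : f.dom a b) (hg : g.dom a b),
    P.tr hP ◁ v hb hb' ≫ (g.nat ha' hb' hP hQ hg).hom =
      (f.nat ha hb hP hQ hf).hom ≫ u ha ha' ▷ Q.tr hQ

/-- The fibre at `a` consists of functions of the proofs of membership in `V` and `V'`, so that it
makes sense at every point of `Z`. Sections through a given value are obtained by carrying it back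
to the centre of a small neighbourhood and from there to all other points; `square_triangle` gives
the compatibility. -/
theorem isLocalSystem (f : HomOn V P Q) (g : HomOn V' P Q) (hV : IsOpen V) (hV' : IsOpen V') :
    IsLocalSystem (Rel f g) (V ∩ V') where
  unique a ha := by
    filter_upwards [P.eventually_dom₁ a, Q.eventually_dom₁ a, f.eventually_dom a ha.1,
      g.eventually_dom a ha.2] with b hP hQ hf hg hb u u' v v' h h'
    have := square_unique (P.tr_equivalence hP) (Q.tr_equivalence hQ)
      (h ha.1 ha.2 hb.1 hb.2 hP hQ hf hg) (h' ha.1 ha.2 hb.1 hb.2 hP hQ hf hg)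
    exact ⟨fun e => by subst e; funext _ _; exact this.1 rfl,
      fun e => by subst e; funext _ _; exact this.2 rfl⟩
  exists_section a ha := by
    obtain ⟨O, hO, hOo, haO⟩ := eventually_nhds_iff.1
      ((hV.eventually_mem ha.1).and ((hV'.eventually_mem ha.2).and
      ((P.eventually_dom₁ a).and ((Q.eventually_dom₁ a).and ((f.eventually_dom a ha.1).and
      ((g.eventually_dom a ha.2).and ((P.eventually_dom₂ a).and ((Q.eventually_dom₂ a).and
      ((f.nat_comp a ha.1).and (g.nat_comp a ha.2))))))))))
    choose hV hV' hP hQ hf hg hP₂ hQ₂ hfc hgc using hO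
    refine ⟨O, hOo, haO, fun b hb => ⟨hV b hb, hV' b hb⟩, fun b hb v => ?_⟩
    obtain ⟨u, hu⟩ := square_exists' (Q.tr_equivalence (hQ b hb))
      (f.nat ha.1 (hV b hb) (hP b hb) (hQ b hb) (hf b hb))
      (g.nat ha.2 (hV' b hb) (hP b hb) (hQ b hb) (hg b hb)) (v (hV b hb) (hV' b hb))
    choose m hm using fun c (hc : c ∈ O) => square_exists (P.tr_equivalence (hP c hc))
      (f.nat ha.1 (hV c hc) (hP c hc) (hQ c hc) (hf c hc))
      (g.nat ha.2 (hV' c hc) (hP c hc) (hQ c hc) (hg c hc)) u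
    refine ⟨fun c hc _ _ => m c hc, fun c hc => ?_, ?_⟩
    · filter_upwards [hP₂ c hc, hQ₂ c hc, hfc c hc, hgc c hc] with d hPd hQd hfd hgd
      intro hd _ _ _ _ hPcd hQcd hfcd hgcd
      exact square_triangle (P.tr_equivalence (hP c hc))
        (hfd ha.1 (hV c hc) (hV d hd) (hP c hc) hPcd (hP d hd) hPd (hQ c hc) hQcd (hQ d hd) hQd
          (hf c hc) hfcd (hf d hd))
        (hgd ha.2 (hV' c hc) (hV' d hd) (hP c hc) hPcd (hP d hd) hPd (hQ c hc) hQcd (hQ d hd) hQd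
          (hg c hc) hgcd (hg d hd)) (hm c hc) (hm d hd)
    · funext _ _
      exact (square_unique (P.tr_equivalence (hP b hb)) (Q.tr_equivalence (hQ b hb))
        (hm b hb) hu).1 rfl

theorem isSection_id (f : HomOn V P Q) : IsSection (Rel f f) W fun a _ h _ => 𝟙 (f.app a h) :=
  fun _ _ => Eventually.of_forall fun _ _ _ _ _ _ _ _ _ _ => by simp

theorem _root_.HigherMonodromy.IsSection.comp {f : HomOn V P Q} {g : HomOn V' P Q}
    {k : HomOn V'' P Q} {m : ∀ a ∈ W, ∀ (h : a ∈ V) (h' : a ∈ V'), f.app a h ⟶ g.app a h'}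
    {n : ∀ a ∈ W, ∀ (h : a ∈ V') (h' : a ∈ V''), g.app a h ⟶ k.app a h'}
    (hm : IsSection (Rel f g) W m) (hn : IsSection (Rel g k) W n) (hW : W ⊆ V') :
    IsSection (Rel f k) W fun a ha h h' => m a ha h (hW ha) ≫ n a ha (hW ha) h' := by
  intro a ha
  filter_upwards [hm a ha, hn a ha, g.eventually_dom a (hW ha)] with b hmb hnb hg
  intro hb hf hk hf' hk' hP hQ hfd hkd
  rw [whiskerLeft_comp, Category.assoc, hnb hb (hW ha) hk (hW hb) hk' hP hQ hg hkd,
    reassoc_of% hmb hb hf (hW ha) hf' (hW hb) hP hQ hfd hg, comp_whiskerRight]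

theorem _root_.HigherMonodromy.IsSection.symm {f : HomOn V P Q} {g : HomOn V' P Q}
    {m : ∀ a ∈ W, ∀ (h : a ∈ V) (h' : a ∈ V'), f.app a h ≅ g.app a h'}
    (hm : IsSection (Rel f g) W fun a ha h h' => (m a ha h h').hom) :
    IsSection (Rel g f) W fun a ha h h' => (m a ha h' h).inv := by
  intro a ha
  filter_upwards [hm a ha] with b hb
  intro hbW _ _ _ _ hP hQ hg hf
  exact iso_coh _ _ (hb hbW _ _ _ _ hP hQ hf hg)

/-- An invertible 2-arrow between stalks extends to a neighbourhood. -/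
theorem exists_local_iso (f : HomOn V P Q) (g : HomOn V' P Q) (hV : IsOpen V) (hV' : IsOpen V')
    {a : Z} (ha : a ∈ V) (ha' : a ∈ V') (e : f.app a ha ≅ g.app a ha') :
    ∃ O, IsOpen O ∧ a ∈ O ∧ O ⊆ V ∩ V' ∧
      ∃ θ : ∀ b ∈ O, ∀ (h : b ∈ V) (h' : b ∈ V'), f.app b h ≅ g.app b h',
        IsSection (Rel f g) O fun b hb h h' => (θ b hb h h').hom := by
  obtain ⟨O₁, hO₁, ha₁, hOV₁, H₁⟩ := (isLocalSystem f g hV hV').exists_section a ⟨ha, ha'⟩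
  obtain ⟨O₂, hO₂, ha₂, hOV₂, H₂⟩ := (isLocalSystem g f hV' hV).exists_section a ⟨ha', ha⟩
  obtain ⟨m, hm, hma⟩ := H₁ a ha₁ fun _ _ => e.hom
  obtain ⟨n, hn, hna⟩ := H₂ a ha₂ fun _ _ => e.inv
  have hs : O₁ ∩ O₂ ⊆ V ∩ V' := Set.inter_subset_left.trans hOV₁
  have hm' := hm.mono (Set.inter_subset_left (t := O₂))
  have hn' := hn.mono (Set.inter_subset_right (s := O₁))
  -- The separately extended inverses compose to the identity at `a`, hence on a neighbourhood of
  -- `a`.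
  have e₁ := (hm'.comp hn' fun b hb => (hs hb).2).eventually_eq_iff (isLocalSystem f f hV hV)
    (isSection_id (W := O₁ ∩ O₂) f) (fun b hb => ⟨(hs hb).1, (hs hb).1⟩) ⟨ha₁, ha₂⟩ ⟨ha₁, ha₂⟩
  have e₂ := (hn'.comp hm' fun b hb => (hs hb).1).eventually_eq_iff (isLocalSystem g g hV' hV')
    (isSection_id (W := O₁ ∩ O₂) g) (fun b hb => ⟨(hs hb).2, (hs hb).2⟩) ⟨ha₁, ha₂⟩ ⟨ha₁, ha₂⟩
  obtain ⟨O, hO, hOo, haO⟩ := eventually_nhds_iff.1 (e₁.and e₂)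
  have hb₁ : ∀ b (hb : b ∈ O) (hb' : b ∈ O₁ ∩ O₂) h h',
      m b hb'.1 h h' ≫ n b hb'.2 h' h = 𝟙 _ := fun b hb hb' h h' => by
    refine congrFun (congrFun (((hO b hb).1 hb' hb').1 ?_) h) h
    funext _ _
    simp [hma, hna]
  have hb₂ : ∀ b (hb : b ∈ O) (hb' : b ∈ O₁ ∩ O₂) h h',
      n b hb'.2 h' h ≫ m b hb'.1 h h' = 𝟙 _ := fun b hb hb' h h' => by
    refine congrFun (congrFun (((hO b hb).2 hb' hb').1 ?_) h') h'
    funext _ _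
    simp [hma, hna]
  exact ⟨O ∩ (O₁ ∩ O₂), hOo.inter (hO₁.inter hO₂), ⟨haO, ha₁, ha₂⟩,
    Set.inter_subset_right.trans hs,
    fun b hb h h' => ⟨m b hb.2.1 h h', n b hb.2.2 h' h, hb₁ b hb.1 hb.2 h h',
      hb₂ b hb.1 hb.2 h h'⟩, hm'.mono Set.inter_subset_right⟩

/-- Locally, 1-arrows between stalks extend to 1-arrows between sections, up to isomorphism. -/
theorem exists_local_hom (P Q : LocConstStack Z C) (a : Z) :
    ∃ V, IsOpen V ∧ a ∈ V ∧ ∀ b (hb : b ∈ V) (k : P.obj b ⟶ Q.obj b),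
      ∃ f : HomOn V P Q, Nonempty (f.app b hb ≅ k) := by
  obtain ⟨V, hV, hVo, haV⟩ := eventually_nhds_iff.1
    ((P.eventually_dom₁ a).and ((Q.eventually_dom₁ a).and ((P.eventually_dom₂ a).and
    ((Q.eventually_dom₂ a).and ((P.trComp_assoc a).and (Q.trComp_assoc a))))))
  choose hP hQ hP₂ hQ₂ hPa hQa using hV
  refine ⟨V, hVo, haV, fun b hb k => ?_⟩
  -- `u` is `k` carried back to the centre `a`; the stalks `f c` are then obtained by carrying `u`
  -- outwards, and the 2-arrows `nat` by solving `nat_comp` for the triangles with vertex `a`.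
  obtain ⟨u, ⟨e⟩⟩ : ∃ u, Nonempty (P.tr (hP b hb) ≫ k ≅ u ≫ Q.tr (hQ b hb)) := by
    obtain ⟨g, -, ⟨e⟩⟩ := Q.tr_equivalence (hQ b hb)
    exact ⟨P.tr (hP b hb) ≫ k ≫ g, ⟨whiskerLeftIso _ ((ρ_ k).symm ≪≫ whiskerLeftIso k e.symm ≪≫
      (α_ _ _ _).symm) ≪≫ (α_ _ _ _).symm⟩⟩
  have : ∀ c (hc : c ∈ V), ∃ f, Nonempty (P.tr (hP c hc) ≫ f ≅ u ≫ Q.tr (hQ c hc)) := by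
    intro c hc
    obtain ⟨g, ⟨e⟩, -⟩ := P.tr_equivalence (hP c hc)
    exact ⟨g ≫ u ≫ Q.tr (hQ c hc), ⟨(α_ _ _ _).symm ≪≫ whiskerRightIso e _ ≪≫ λ_ _⟩⟩
  choose f s using this
  have s := fun c hc => (s c hc).some
  choose n hn using fun c (hc : c ∈ V) d (hd : d ∈ V) (hPcd : P.dom₁ c d) (hQcd : Q.dom₁ c d)
    (h₂ : P.dom₂ a c d) (h₂' : Q.dom₂ a c d) =>
    exists_nat (P.trComp (hP c hc) hPcd (hP d hd) h₂) (Q.trComp (hQ c hc) hQcd (hQ d hd) h₂')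
      (s c hc) (s d hd) (P.tr_equivalence _)
  refine ⟨⟨f, fun c d => P.dom₂ a c d ∧ Q.dom₂ a c d, fun c hc => (hP₂ c hc).and (hQ₂ c hc),
    fun {c d} hc hd hPcd hQcd h => n c hc d hd hPcd hQcd h.1 h.2, fun c hc => ?_⟩, ?_⟩
  · filter_upwards [hPa c hc, hQa c hc] with d hPd hQd
    filter_upwards [hPd, hQd] with e hPe hQe
    intro hc hd he hPcd hPde hPce hP' hQcd hQde hQce hQ' hcd hde hce
    exact nat_tetrahedron (P.tr_equivalence (hP c hc))
      (hPe (hP c hc) (hP d hd) (hP e he) hPcd hPce hPde hcd.1 hce.1 hde.1 hP')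
      (hQe (hQ c hc) (hQ d hd) (hQ e he) hQcd hQce hQde hcd.2 hce.2 hde.2 hQ')
      (hn _ _ _ _ _ _ _ _) (hn _ _ _ _ _ _ _ _) (hn _ _ _ _ _ _ _ _)
  · obtain ⟨i, -⟩ := (P.tr_equivalence (hP b hb)).exists_whiskerLeftIso (s b hb ≪≫ e.symm)
    exact ⟨i⟩

/-- 1-arrows which are isomorphic on overlaps, compatibly, can be glued. -/
theorem exists_glue {ι : Type*} {V : ι → Set Z} (hV : ∀ i, IsOpen (V i))
    (f : ∀ i, HomOn (V i) P Q)
    (θ : ∀ i j a (hi : a ∈ V i) (hj : a ∈ V j), (f i).app a hi ≅ (f j).app a hj)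
    (hθ : ∀ i j, IsSection (Rel (f i) (f j)) (V i ∩ V j) fun a _ hi hj => (θ i j a hi hj).hom)
    (hcomp : ∀ i j k a hi hj hk,
      (θ i j a hi hj).hom ≫ (θ j k a hj hk).hom = (θ i k a hi hk).hom)
    (hW : ∀ a ∈ W, ∃ i, a ∈ V i) :
    ∃ g : HomOn W P Q, ∃ η : ∀ i a (ha : a ∈ W) (hi : a ∈ V i), g.app a ha ≅ (f i).app a hi,
      (∀ i, IsSection (Rel g (f i)) (W ∩ V i) fun a _ ha hi => (η i a ha hi).hom) ∧
      ∀ i j a ha hi hj, (η i a ha hi).hom ≫ (θ i j a hi hj).hom = (η j a ha hj).hom := by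
  choose i hi using hW
  -- The stalk at `a` is taken from the chart `i a`. Towards a nearby `b` one changes at `b` from
  -- the chart `i b` to `i a` and applies the structure of the latter, which requires `b` to lie in
  -- the chart of `a`; this is recorded in `dom`.
  refine ⟨⟨fun a ha => (f (i a ha)).app a (hi a ha),
    fun a b => ∀ ha : a ∈ W, b ∈ V (i a ha) ∧ (f (i a ha)).dom a b, fun a ha => ?_,
    fun {a b} ha hb hP hQ h => whiskerLeftIso (P.tr hP) (θ _ _ b (hi b hb) (h ha).1) ≪≫
      (f (i a ha)).nat (hi a ha) (h ha).1 hP hQ (h ha).2, fun a ha => ?_⟩,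
    fun j a ha hj => θ _ j a (hi a ha) hj, fun j a ha => ?_, fun j k a ha hj hk => hcomp _ _ _ _ _ _ _⟩
  · filter_upwards [(hV _).mem_nhds (hi a ha), (f (i a ha)).eventually_dom a (hi a ha)]
      with b h₁ h₂ _
    exact ⟨h₁, h₂⟩
  · filter_upwards [(hV _).mem_nhds (hi a ha), (f (i a ha)).nat_comp a (hi a ha)] with b hb hfb
    by_cases hbW : b ∈ W
    swap
    · exact Eventually.of_forall fun _ _ h => absurd h hbW
    filter_upwards [hfb, (hV _).mem_nhds hb, (hV _).mem_nhds (hi b hbW),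
      (f (i a ha)).eventually_dom b hb, hθ (i b hbW) (i a ha) b ⟨hi b hbW, hb⟩]
      with c hfc hc hcb hd hθc
    intro _ _ hcW hPab hPbc hPac hP hQab hQbc hQac hQ hab hbc hac
    exact nat_comp_glue (hfc (hi a ha) hb hc hPab hPbc hPac hP hQab hQbc hQac hQ (hab ha).2 hd
      (hac ha).2) (hθc ⟨hcb, hc⟩ (hi b hbW) hb hcb hc hPbc hQbc (hbc hbW).2 hd)
      (hcomp _ _ _ _ _ _ _)
  · filter_upwards [hθ (i a ha.1) j a ⟨hi a ha.1, ha.2⟩] with b hb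
    intro hbW _ _ _ _ hP hQ hf hg
    have := hb ⟨(hf ha.1).1, hbW.2⟩ (hi a ha.1) ha.2 (hf ha.1).1 hbW.2 hP hQ (hf ha.1).2 hg
    dsimp
    rw [Category.assoc, ← this, ← hcomp (i b hbW.1) (i a ha.1) j b _ (hf ha.1).1 hbW.2,
      whiskerLeft_comp, Category.assoc]
    rfl

end HomOn

end HomOn

end LocConstStack

/-! ### Identities between comparisons through a common target, used on the slice. -/

section IsoLemmas

variable {C : Type u} [Category.{v} C] {a b c d : C}

theorem comp_eq_id_of_iso {m : a ⟶ b} {n : b ⟶ a} (e : a ≅ b) (hm : m = e.hom)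
    (hn : n = e.inv) : m ≫ n = 𝟙 a := by
  rw [hm, hn, e.hom_inv_id]

theorem trans_symm_comp (e : a ≅ d) (f : b ≅ d) (g : c ≅ d) {m : a ⟶ b} {n : b ⟶ c} {k : a ⟶ c}
    (hm : m = (e ≪≫ f.symm).hom) (hn : n = (f ≪≫ g.symm).hom) (hk : k = (e ≪≫ g.symm).hom) :
    m ≫ n = k := by
  rw [hm, hn, hk]
  simp

theorem comp_eq_of_trans_symm (e : b ≅ d) (f : c ≅ d) {m : a ⟶ b} {n : a ⟶ c} {k : b ⟶ c}
    (h : m ≫ k = n) (hk : k = (e ≪≫ f.symm).hom) : m ≫ e.hom = n ≫ f.hom := by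
  rw [← h, hk]
  simp

theorem square_refl {C : Type u} [Bicategory.{w, v} C] {p₀ p₁ q₀ q₁ : C} {a : p₀ ⟶ p₁}
    {b : q₀ ⟶ q₁} {f₀ : p₀ ⟶ q₀} {f₁ : p₁ ⟶ q₁} (s : a ≫ f₁ ⟶ f₀ ≫ b) :
    a ◁ 𝟙 f₁ ≫ s = s ≫ 𝟙 f₀ ▷ b := by
  simp

end IsoLemmas

namespace LocConstStack

/-! ### Extension of 1-arrows and 2-arrows from a slice. -/

section Extension

variable {X : Type*} [TopologicalSpace X] {C : Type u} [Bicategory.{w, v} C]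
  {P Q : LocConstStack (X × unitInterval) C} {r : unitInterval}

namespace HomOn

variable {V V' : Set (X × unitInterval)}

theorem tendsto_slice (r : unitInterval) (x : X) :
    Tendsto (fun y : X => (y, r)) (𝓝 x) (𝓝 (x, r)) :=
  (Continuous.prodMk_left r).tendsto x

/-- The restriction of a 1-arrow to the slice at `r`. -/
def sliceAt (r : unitInterval) (f : HomOn V P Q) :
    HomOn {y | (y, r) ∈ V} (pullbackObj (slice X r) P) (pullbackObj (slice X r) Q) where
  app y hy := f.app (y, r) hy
  dom y y' := f.dom (y, r) (y', r)
  eventually_dom y hy := (tendsto_slice r y).eventually (f.eventually_dom (y, r) hy)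
  nat ha hb hP hQ hd := f.nat ha hb hP hQ hd
  nat_comp y hy := ((tendsto_slice r y).eventually (f.nat_comp (y, r) hy)).mono
    fun y' h => (tendsto_slice r y').eventually h

theorem _root_.HigherMonodromy.IsSection.sliceAt {f : HomOn V P Q} {g : HomOn V' P Q}
    {W : Set (X × unitInterval)}
    {m : ∀ a ∈ W, ∀ (h : a ∈ V) (h' : a ∈ V'), f.app a h ⟶ g.app a h'}
    (hm : IsSection (Rel f g) W m) (r : unitInterval) :
    IsSection (Rel (f.sliceAt r) (g.sliceAt r)) {y | (y, r) ∈ W} fun y hy h h' =>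
      m (y, r) hy h h' :=
  fun y hy => (tendsto_slice r y).eventually (hm (y, r) hy)

/-- Invertible 2-arrows over the slice at `r` extend to star-shaped open sets. -/
theorem exists_iso_extension (f : HomOn V P Q) (g : HomOn V' P Q) (hV : IsOpen V)
    (hV' : IsOpen V') (hr : IsStar r (V ∩ V'))
    (e : ∀ y (h : (y, r) ∈ V) (h' : (y, r) ∈ V'), f.app (y, r) h ≅ g.app (y, r) h')
    (he : IsSection (Rel (f.sliceAt r) (g.sliceAt r)) {y | (y, r) ∈ V ∩ V'}
      fun y _ h h' => (e y h h').hom) :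
    ∃ θ : ∀ a (h : a ∈ V) (h' : a ∈ V'), f.app a h ≅ g.app a h',
      IsSection (Rel f g) (V ∩ V') (fun a _ h h' => (θ a h h').hom) ∧
      ∀ y h h', (θ (y, r) h h').hom = (e y h h').hom := by
  obtain ⟨m, hm, hme⟩ := (isLocalSystem f g hV hV').exists_extension hr
    (fun y _ h h' => (e y h h').hom) he
  obtain ⟨n, hn, hne⟩ := (isLocalSystem g f hV' hV).exists_extension
    (Set.inter_comm V V' ▸ hr) (fun y _ h h' => (e y h' h).inv)
    (fun y hy => (he.symm y hy.symm).mono fun _ H h => H h.symm)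
  have hn : IsSection (Rel g f) (V ∩ V') fun a ha => n a ha.symm := hn.mono fun _ ha => ha.symm
  -- The extensions of the 2-arrow and of its inverse compose to identities on the slice, hence
  -- everywhere by uniqueness.
  have h₁ := (hm.comp hn Set.inter_subset_right).eq_of_isStar (isLocalSystem f f hV hV)
    (isSection_id f) (fun _ h => ⟨h.1, h.1⟩) hr fun y hy => by
      funext h _
      exact comp_eq_id_of_iso (e y h hy.2) (congrFun (congrFun (hme y hy) h) hy.2)
        (congrFun (congrFun (hne y hy.symm) hy.2) h)
  have h₂ := (hn.comp hm Set.inter_subset_left).eq_of_isStar (isLocalSystem g g hV' hV')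
    (isSection_id g) (fun _ h => ⟨h.2, h.2⟩) hr fun y hy => by
      funext h _
      exact comp_eq_id_of_iso (e y hy.1 h).symm (congrFun (congrFun (hne y hy.symm) h) hy.1)
        (congrFun (congrFun (hme y hy) hy.1) h)
  exact ⟨fun a h h' => ⟨m a ⟨h, h'⟩ h h', n a ⟨h', h⟩ h' h,
    congrFun (congrFun (h₁ a ⟨h, h'⟩) h) h, congrFun (congrFun (h₂ a ⟨h, h'⟩) h') h'⟩, hm,
    fun y h h' => congrFun (congrFun (hme y ⟨h, h'⟩) h) h'⟩

/-- An extension to `V` of a 1-arrow over a subset of the slice at `r`. -/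
structure Extension (r : unitInterval) {U : Set X}
    (k : HomOn U (pullbackObj (slice X r) P) (pullbackObj (slice X r) Q))
    (V : Set (X × unitInterval)) where
  hom : HomOn V P Q
  iso : ∀ y (h : (y, r) ∈ V) (h' : y ∈ U), hom.app (y, r) h ≅ k.app y h'
  isSection : IsSection (Rel (hom.sliceAt r) k) {y | (y, r) ∈ V}
    fun y _ h h' => (iso y h h').hom

variable {U : Set X} {k : HomOn U (pullbackObj (slice X r) P) (pullbackObj (slice X r) Q)}

/-- Two extensions of `k` are compared on the slice through `k`. This comparison extends uniquely to
the star-shaped overlap, and on triple overlaps the cocycle condition holds because it holds on the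
slice. -/
theorem Extension.exists_glue {ι : Type*} {V : ι → Set (X × unitInterval)}
    (hV : ∀ i, IsOpen (V i)) (hr : ∀ i, IsStar r (V i)) (hU : ∀ i y, (y, r) ∈ V i → y ∈ U)
    (E : ∀ i, Extension r k (V i)) {W : Set (X × unitInterval)}
    (hW : ∀ a ∈ W, ∃ i, a ∈ V i) :
    ∃ E' : Extension r k W, ∃ η : ∀ i a (ha : a ∈ W) (hi : a ∈ V i),
      E'.hom.app a ha ≅ (E i).hom.app a hi,
      ∀ i, IsSection (Rel E'.hom (E i).hom) (W ∩ V i) fun a _ ha hi => (η i a ha hi).hom := by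
  have key := fun i j => (E i).hom.exists_iso_extension (E j).hom (hV i) (hV j)
    ((hr i).inter (hr j))
    (fun y h h' => (E i).iso y h (hU i y h) ≪≫ ((E j).iso y h' (hU i y h)).symm)
    (((E i).isSection.mono fun _ h => h.1).comp
      (((E j).isSection.mono fun _ h => h.2).symm) fun y h => hU i y h.1)
  choose θ hθ hθr using key
  obtain ⟨g, η, hη, hηθ⟩ := HomOn.exists_glue hV (fun i => (E i).hom) θ hθ
    (fun i j l a hi hj hl => by
      have hs : V i ∩ V j ∩ V l ⊆ V i ∩ V l := fun _ h => ⟨h.1.1, h.2⟩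
      exact congrFun (congrFun ((((hθ i j).mono Set.inter_subset_left).comp
        ((hθ j l).mono fun _ h => ⟨h.1.2, h.2⟩) fun _ h => h.1.2).eq_of_isStar
          (isLocalSystem (E i).hom (E l).hom (hV i) (hV l)) ((hθ i l).mono hs) hs
          (((hr i).inter (hr j)).inter (hr l)) (fun y hy => by
            funext _ _
            exact trans_symm_comp _ _ _ (hθr _ _ _ _ _) (hθr _ _ _ _ _) (hθr _ _ _ _ _))
              a ⟨⟨hi, hj⟩, hl⟩) hi) hl) hW
  choose i hi using hW
  -- The comparison with `k` does not depend on the chart; this is needed because the chosen chart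
  -- varies with `y`.
  have hηi : ∀ i j y (h : (y, r) ∈ W) hi hj hy,
      (η i (y, r) h hi).hom ≫ ((E i).iso y hi hy).hom =
        (η j (y, r) h hj).hom ≫ ((E j).iso y hj hy).hom := fun i j y h hi hj hy =>
    comp_eq_of_trans_symm _ _ (hηθ i j (y, r) h hi hj) (hθr i j y hi hj)
  refine ⟨⟨g, fun y h h' => η (i _ h) (y, r) h (hi _ h) ≪≫ (E _).iso y (hi _ h) h',
    fun y hy => ?_⟩, η, hη⟩
  have hs := (((hη (i _ hy)).sliceAt r).comp ((E (i _ hy)).isSection.mono fun _ h => h.2)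
    fun _ h => h.2) y ⟨hy, hi _ hy⟩
  filter_upwards [hs, (tendsto_slice r y).eventually ((hV _).eventually_mem (hi _ hy))]
    with y' h hy' hW' ha ha' hb hb' hP hQ hf hg
  have := h ⟨hW', hy'⟩ ha ha' hb hb' hP hQ hf hg
  exact (congrArg
    (fun m => (pullbackObj (slice X r) P).tr hP ◁ m ≫ (k.nat ha' hb' hP hQ hg).hom)
    (hηi (i (y', r) hb) (i (y, r) hy) y' hb (hi _ hb) hy' hb')).trans this

/-- Existence of a star-shaped extension around `(x, q)` is a locally constant property of `q`, and
it holds at `q = r`; the extensions obtained at all points are then glued. -/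
theorem Extension.exists_univ
    (k : HomOn Set.univ (pullbackObj (slice X r) P) (pullbackObj (slice X r) Q)) :
    Nonempty (Extension r k Set.univ) := by
  let Ext (V : Set (X × unitInterval)) : Prop :=
    IsOpen V ∧ IsStar r V ∧ Nonempty (Extension r k V)
  have key : ∀ a, ∃ V, a ∈ V ∧ Ext V := by
    rintro ⟨x, s⟩
    refine uIcc_induction (r := r) (s := s) (fun q => ∃ V, (x, q) ∈ V ∧ Ext V) ?_ ?_
    · obtain ⟨V, hVo, hxV, hV⟩ := exists_local_hom P Q (x, r)
      obtain ⟨f, ⟨e⟩⟩ := hV _ hxV (k.app x trivial)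
      obtain ⟨O, hO, hxO, hOV, θ, hθ⟩ := exists_local_iso (f.sliceAt r) k
        (hVo.preimage (Continuous.prodMk_left r)) isOpen_univ hxV trivial e
      obtain ⟨U, N, hU, hxU, hN, hrN, hNc, hUN⟩ := exists_tube (hVo.mem_nhds hxV)
      have hs : (U ∩ O) ×ˢ N ⊆ V := (Set.prod_mono Set.inter_subset_left subset_rfl).trans hUN
      exact ⟨(U ∩ O) ×ˢ N, ⟨⟨hxU, hxO⟩, hrN⟩, (hU.inter hO).prod hN, isStar_prod hNc hrN,
        ⟨⟨f.restrict hs, fun y h h' => θ y h.1.2 (hs h) h', fun y hy =>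
          (hθ y hy.1.2).mono fun y' H hW' ha ha' hb hb' => H hb.1.2 (hs ha) ha' (hs hb) hb'⟩⟩⟩
    · intro q hq
      obtain ⟨V, hVo, hxV, hV⟩ := exists_local_hom P Q (x, q)
      obtain ⟨U, N, hU, hxU, hN, hqN, hNc, hUN⟩ := exists_tube (hVo.mem_nhds hxV)
      have step : ∀ q₁ ∈ N, ∀ q₂ ∈ N, (∃ V, (x, q₁) ∈ V ∧ Ext V) →
          ∃ V, (x, q₂) ∈ V ∧ Ext V := by
        rintro q₁ hq₁ q₂ hq₂ ⟨V₁, hx₁, hV₁o, hV₁r, ⟨E₁⟩⟩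
        have hx₁V : (x, q₁) ∈ V := hUN ⟨hxU, hq₁⟩
        obtain ⟨f, ⟨e⟩⟩ := hV _ hx₁V (E₁.hom.app _ hx₁)
        obtain ⟨O, hO, hxO, hOV, θ, hθ⟩ := exists_local_iso f E₁.hom hVo hV₁o hx₁V hx₁ e
        let U' : Set X := U ∩ {y | (y, q₁) ∈ O}
        have hU' : IsOpen U' := hU.inter (hO.preimage (Continuous.prodMk_left q₁))
        have hUs : ∀ y ∈ U', (y, q₁) ∈ V₁ := fun y hy => (hOV hy.2).2
        have hs : U' ×ˢ N ⊆ V := (Set.prod_mono Set.inter_subset_left subset_rfl).trans hUN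
        have hUo : IsOpen (U' ×ˢ N) := hU'.prod hN
        have hUo' : IsOpen (V₁ ∩ U' ×ˢ (Set.univ : Set unitInterval)) :=
          hV₁o.inter (hU'.prod isOpen_univ)
        let V' : Bool → Set (X × unitInterval) := fun i => i.rec (U' ×ˢ N)
          (V₁ ∩ U' ×ˢ Set.univ)
        -- The centre is temporarily `q₁`: the local 1-arrow on the tube (through `θ`) and the old
        -- extension (through the identity) are both extensions of the slice of `E₁.hom` at `q₁`, so
        -- they glue.
        let k' := (E₁.hom.sliceAt q₁).restrict hUs
        let E' : ∀ i, Extension q₁ k' (V' i) := fun i => i.rec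
          ⟨f.restrict hs, fun y h h' => θ (y, q₁) h'.2 (hs h) (hUs y h'), fun y hy =>
            (hθ.sliceAt q₁ y hy.1.2).mono fun y' H hW' ha ha' hb hb' =>
              H hb'.2 (hs ha) (hUs _ ha') (hs hb) (hUs _ hb')⟩
          ⟨E₁.hom.restrict Set.inter_subset_left, fun y h h' => Iso.refl _, fun y hy =>
            Eventually.of_forall fun y' hW' ha ha' hb hb' hP hQ hf hg =>
              square_refl (E₁.hom.nat (hUs _ ha') (hUs _ hb') hP hQ hf).hom⟩
        obtain ⟨E, η, hη⟩ := Extension.exists_glue (V := V')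
          (by rintro (_ | _); exacts [hUo, hUo'])
          (by
            rintro (_ | _)
            exacts [isStar_prod hNc hq₁,
              hV₁r.inter_prod Set.ordConnected_univ trivial hUs])
          (by rintro (_ | _) y hy; exacts [hy.1, hy.2.1]) E'
          (W := V₁ ∩ U' ×ˢ Set.univ ∪ U' ×ˢ N)
          (by rintro a (ha | ha); exacts [⟨true, ha⟩, ⟨false, ha⟩])
        -- Return to the centre `r`: points of the new set at level `r` lie in the old piece, so the
        -- comparison with `k` is that of `E₁` preceded by `η true`.
        have hyr : ∀ y, (y, r) ∈ V₁ ∩ U' ×ˢ Set.univ ∪ U' ×ˢ N → (y, r) ∈ V' true := by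
          intro y hy
          have hyU : y ∈ U' := by
            rcases hy with hy | hy
            exacts [hy.2.1, hy.1]
          exact ⟨hV₁r.base (hUs y hyU), hyU, trivial⟩
        refine ⟨_, Or.inr ⟨⟨hxU, hxO⟩, hq₂⟩, hUo'.union hUo,
          hV₁r.union_prod hNc hq₁ hUs, ⟨⟨E.hom, fun y h h' =>
            η true (y, r) h (hyr y h) ≪≫ E₁.iso y (hyr y h).1 h', ?_⟩⟩⟩
        have hE₁ : IsSection (Rel ((E' true).hom.sliceAt r) k) {y | (y, r) ∈ V' true}
            fun y _ h h' => (E₁.iso y h.1 h').hom := fun y hy =>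
          (E₁.isSection y hy.1).mono fun y' H hW' ha ha' hb hb' => H hb.1 ha.1 ha' hb.1 hb'
        have := ((((hη true).sliceAt r).mono fun y hy => ⟨hy, hyr y hy⟩).comp (hE₁.mono hyr) hyr)
        exact this
      filter_upwards [hN.mem_nhds hqN] with q' hq' _
      exact ⟨step q hqN q' hq', step q' hq' q hqN⟩
  choose V hV hVo hVr E using key
  obtain ⟨E', -⟩ := Extension.exists_glue hVo hVr (fun _ _ _ => trivial) (fun a => (E a).some)
    (W := Set.univ) fun a _ => ⟨a, hV a⟩
  exact ⟨E'⟩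

end HomOn

/-- Restriction to a slice is essentially surjective on 1-arrows. -/
theorem exists_hom_extension (t : unitInterval)
    (k : pullbackObj (slice X t) P ⟶ pullbackObj (slice X t) Q) :
    ∃ f : P ⟶ Q, Nonempty (pullbackHom (slice X t) f ≅ k) := by
  obtain ⟨E⟩ := HomOn.Extension.exists_univ (HomOn.ofHom k)
  exact ⟨E.hom.toHom, ⟨isoMk (f := pullbackHom (slice X t) E.hom.toHom) (g := k)
    (fun y => E.iso y trivial trivial) fun y => (E.isSection y trivial).mono
      fun y' h hP hQ hf hg => h trivial trivial trivial trivial trivial hP hQ hf hg⟩⟩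

/-- Restriction to a slice is faithful on 2-arrows. -/
theorem hom₂_ext_slice (t : unitInterval) {f g : P ⟶ Q} {m n : f ⟶ g}
    (h : ∀ x, m.app (x, t) = n.app (x, t)) : m = n := by
  have hs : ∀ m : f ⟶ g, IsSection (HomOn.Rel (HomOn.ofHom f) (HomOn.ofHom g)) Set.univ
      fun a _ _ _ => m.app a := fun m a _ =>
    (m.naturality a).mono fun b hb _ _ _ _ _ hP hQ hf hg => hb hP hQ hf hg
  refine Hom₂.ext fun a => congrFun (congrFun ((hs m).eq_of_isStar
    (HomOn.isLocalSystem _ _ isOpen_univ isOpen_univ) (hs n) (by simp)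
    (r := t) (fun _ _ _ _ => trivial) (fun y _ => ?_) a trivial) trivial) trivial
  funext _ _
  exact h y

/-- Restriction to a slice is full on invertible 2-arrows. -/
theorem exists_iso_slice (t : unitInterval) {f g : P ⟶ Q}
    (e : pullbackHom (slice X t) f ≅ pullbackHom (slice X t) g) :
    ∃ m : f ≅ g, ∀ x, m.hom.app (x, t) = e.hom.app x := by
  have he : ∀ x, e.hom.app x ≫ e.inv.app x = 𝟙 _ := fun x =>
    congrArg (fun k => Hom₂.app k x) e.hom_inv_id
  have he' : ∀ x, e.inv.app x ≫ e.hom.app x = 𝟙 _ := fun x =>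
    congrArg (fun k => Hom₂.app k x) e.inv_hom_id
  obtain ⟨θ, hθ, hθe⟩ := HomOn.exists_iso_extension (r := t) (HomOn.ofHom f) (HomOn.ofHom g)
    isOpen_univ isOpen_univ (fun _ _ _ _ => ⟨trivial, trivial⟩)
    (fun y _ _ => ⟨e.hom.app y, e.inv.app y, he y, he' y⟩) fun y _ => (e.hom.naturality y).mono
      fun y' h _ _ _ _ _ hP hQ hf hg => h hP hQ hf hg
  exact ⟨isoMk (fun a => θ a trivial trivial) fun a => (hθ a ⟨trivial, trivial⟩).mono
    fun b h hP hQ hf hg => h ⟨trivial, trivial⟩ trivial trivial trivial trivial hP hQ hf hg,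
    fun x => hθe x trivial trivial⟩

end Extension

end LocConstStack

/-! ### 2-arrows built from isomorphisms with identities, and the equations between them. -/

section Conj

variable {C : Type u} [Bicategory.{w, v} C] {p q s : C}

/-- The invertible 2-arrow `φ ≫ g ≅ f ≫ φ` for 1-arrows `f` and `g` isomorphic to identities. -/
def conj {f : p ⟶ p} {g : q ⟶ q} (e : f ≅ 𝟙 p) (d : g ≅ 𝟙 q) (φ : p ⟶ q) : φ ≫ g ≅ f ≫ φ :=
  whiskerLeftIso φ d ≪≫ ρ_ φ ≪≫ (λ_ φ).symm ≪≫ whiskerRightIso e.symm φ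

/-- The composition of two 1-arrows isomorphic to identities is isomorphic to the identity. -/
def compId {f f' : p ⟶ p} (e : f ≅ 𝟙 p) (e' : f' ≅ 𝟙 p) : f ≫ f' ≅ 𝟙 p :=
  whiskerRightIso e f' ≪≫ λ_ f' ≪≫ e'

theorem conj_refl (φ : p ⟶ q) :
    (ρ_ φ).hom ≫ (λ_ φ).inv = (conj (Iso.refl _) (Iso.refl _) φ).hom := by
  simp [conj]

/-- The lifted 2-arrows are obtained by choice and only their values on the slice are known. Hence
this and the following lemmas take arbitrary 2-arrows together with equations such as `hn`. -/
theorem conj_naturality {f : p ⟶ p} {g : q ⟶ q} (e : f ≅ 𝟙 p) (d : g ≅ 𝟙 q) {φ ψ : p ⟶ q}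
    (m : φ ⟶ ψ) {n : φ ≫ g ⟶ f ≫ φ} {n' : ψ ≫ g ⟶ f ≫ ψ} (hn : n = (conj e d φ).hom)
    (hn' : n' = (conj e d ψ).hom) : m ▷ g ≫ n' = n ≫ f ◁ m := by
  subst hn hn'
  simp only [conj, Iso.trans_hom, whiskerLeftIso_hom, whiskerRightIso_hom, Iso.symm_hom,
    Category.assoc]
  rw [← whisker_exchange_assoc, ← whisker_exchange]
  simp

theorem conj_id {f : p ⟶ p} (e : f ≅ 𝟙 p) {n : 𝟙 p ≫ f ⟶ f ≫ 𝟙 p}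
    (hn : n = (conj e e (𝟙 p)).hom) : n ≫ f ◁ 𝟙 (𝟙 p) = 𝟙 (𝟙 p) ▷ f ≫ (λ_ f).hom ≫ (ρ_ f).inv := by
  subst hn
  simp only [conj, Iso.trans_hom, whiskerLeftIso_hom, whiskerRightIso_hom, Iso.symm_hom,
    Category.assoc]
  simp

theorem conj_comp {f : p ⟶ p} {g : q ⟶ q} {h : s ⟶ s} (e : f ≅ 𝟙 p) (d : g ≅ 𝟙 q) (c : h ≅ 𝟙 s)
    {φ : p ⟶ q} {ψ : q ⟶ s} {n : (φ ≫ ψ) ≫ h ⟶ f ≫ φ ≫ ψ} {n₁ : φ ≫ g ⟶ f ≫ φ}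
    {n₂ : ψ ≫ h ⟶ g ≫ ψ} (hn : n = (conj e c (φ ≫ ψ)).hom) (hn₁ : n₁ = (conj e d φ).hom)
    (hn₂ : n₂ = (conj d c ψ).hom) :
    n ≫ f ◁ 𝟙 (φ ≫ ψ) = 𝟙 (φ ≫ ψ) ▷ h ≫ (α_ _ _ _).hom ≫ φ ◁ n₂ ≫ (α_ _ _ _).inv ≫
      n₁ ▷ ψ ≫ (α_ _ _ _).hom := by
  subst hn hn₁ hn₂
  simp only [conj, Iso.trans_hom, whiskerLeftIso_hom, whiskerRightIso_hom, Iso.symm_hom,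
    Category.assoc]
  simp

/-- Pasting two squares of the form `conj` gives one of the same form. It identifies the naturality
of a composite of transports on the slice. -/
theorem conj_vcomp {f f' : p ⟶ p} {g g' : q ⟶ q} (e : f ≅ 𝟙 p) (d : g ≅ 𝟙 q) (e' : f' ≅ 𝟙 p)
    (d' : g' ≅ 𝟙 q) {φ : p ⟶ q} {n : φ ≫ g ⟶ f ≫ φ} {n' : φ ≫ g' ⟶ f' ≫ φ}
    (hn : n = (conj e d φ).hom) (hn' : n' = (conj e' d' φ).hom) :
    (α_ _ _ _).inv ≫ n ▷ g' ≫ (α_ _ _ _).hom ≫ f ◁ n' ≫ (α_ _ _ _).inv =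
      (conj (compId e e') (compId d d') φ).hom := by
  subst hn hn'
  simp only [conj, compId, Iso.trans_hom, whiskerLeftIso_hom, whiskerRightIso_hom, Iso.symm_hom,
    Category.assoc, Iso.trans_inv, whiskerRightIso_inv]
  have h : e.inv ▷ (φ ≫ g') ≫ f ◁ φ ◁ d'.hom = 𝟙 p ◁ φ ◁ d'.hom ≫ e.inv ▷ (φ ≫ 𝟙 q) :=
    (whisker_exchange _ _).symm
  calc
    _ = 𝟙 _ ⊗≫ φ ◁ d.hom ▷ g' ⊗≫ (e.inv ▷ (φ ≫ g') ≫ f ◁ φ ◁ d'.hom) ⊗≫ f ◁ e'.inv ▷ φ ⊗≫ 𝟙 _ := by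
      bicategory
    _ = 𝟙 _ ⊗≫ φ ◁ d.hom ▷ g' ⊗≫ φ ◁ d'.hom ⊗≫ (e.inv ▷ 𝟙 p ≫ f ◁ e'.inv) ▷ φ ⊗≫ 𝟙 _ := by
      rw [h]; bicategory
    _ = _ := by rw [← whisker_exchange]; bicategory

theorem conj_modification {f f' : p ⟶ p} {g g' : q ⟶ q} (e : f ≅ 𝟙 p) (d : g ≅ 𝟙 q)
    (e' : f' ≅ 𝟙 p) (d' : g' ≅ 𝟙 q) {φ : p ⟶ q} {n : φ ≫ g ⟶ f ≫ φ} {n' : φ ≫ g' ⟶ f' ≫ φ}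
    {m : f ⟶ f'} {k : g ⟶ g'} (hn : n = (conj e d φ).hom) (hn' : n' = (conj e' d' φ).hom)
    (hm : m = (e ≪≫ e'.symm).hom) (hk : k = (d ≪≫ d'.symm).hom) :
    φ ◁ k ≫ n' = n ≫ m ▷ φ := by
  subst hn hn' hm hk
  simp [conj]

variable {D : Type u'} [Bicategory.{w', v'} D]

/-- The image under a 2-functor of a 1-arrow isomorphic to an identity is isomorphic to an
identity. -/
def mapIsoId (G : C ⥤ᵖ D) {f : p ⟶ p} (e : f ≅ 𝟙 p) : G.map f ≅ 𝟙 (G.obj p) :=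
  G.map₂Iso e ≪≫ G.mapId p

theorem mapId_hom_eq (G : C ⥤ᵖ D) (p : C) :
    (G.mapId p).hom = (mapIsoId G (Iso.refl (𝟙 p)) ≪≫ (Iso.refl _).symm).hom := by
  change _ = (G.map₂ (𝟙 _) ≫ (G.mapId p).hom) ≫ 𝟙 _
  simp

/-- Slice form of `square_naturality`. The trivialisations `e` cancel, and the left and right unit
laws of `G` remain. -/
theorem conj_map (G : C ⥤ᵖ D) {f : p ⟶ p} {g : q ⟶ q} (e : f ≅ 𝟙 p) (d : g ≅ 𝟙 q) {φ : p ⟶ q}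
    {f' : G.obj p ⟶ G.obj p} {g' : G.obj q ⟶ G.obj q} (e' : f' ≅ 𝟙 _) (d' : g' ≅ 𝟙 _)
    {n : φ ≫ g ⟶ f ≫ φ} {n' : G.map φ ≫ g' ⟶ f' ≫ G.map φ} {m : G.map f ⟶ f'}
    {k : G.map g ⟶ g'} (hn : n = (conj e d φ).hom) (hn' : n' = (conj e' d' (G.map φ)).hom)
    (hm : m = (mapIsoId G e ≪≫ e'.symm).hom) (hk : k = (mapIsoId G d ≪≫ d'.symm).hom) :
    G.map₂ n ≫ (G.mapComp f φ).hom ≫ m ▷ G.map φ =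
      (G.mapComp φ g).hom ≫ G.map φ ◁ k ≫ n' := by
  subst hn hn' hm hk
  have h : G.map₂ (λ_ φ).inv ≫ G.map₂ (λ_ φ).hom = 𝟙 _ := by
    rw [← PrelaxFunctor.map₂_comp, Iso.inv_hom_id, PrelaxFunctor.map₂_id]
  rw [G.map₂_left_unitor] at h
  have h' : G.map₂ (λ_ φ).inv ≫ (G.mapComp (𝟙 p) φ).hom ≫ (G.mapId p).hom ▷ G.map φ =
      (λ_ (G.map φ)).inv := by
    rw [← cancel_mono (λ_ (G.map φ)).hom]
    simpa using h
  simp only [conj, mapIsoId, Iso.trans_hom, whiskerLeftIso_hom, whiskerRightIso_hom,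
    Iso.symm_hom, PrelaxFunctor.map₂_comp, Pseudofunctor.map₂_whisker_left,
    Pseudofunctor.map₂_whisker_right, Pseudofunctor.map₂_right_unitor, Category.assoc,
    comp_whiskerRight, whiskerLeft_comp, Iso.inv_hom_id_assoc, PrelaxFunctor.map₂Iso_hom]
  have h₃ : G.map₂ e.inv ▷ G.map φ ≫ G.map₂ e.hom ▷ G.map φ = 𝟙 _ := by
    rw [← comp_whiskerRight, ← PrelaxFunctor.map₂_comp, Iso.inv_hom_id, PrelaxFunctor.map₂_id,
      id_whiskerRight]
  rw [reassoc_of% h₃, reassoc_of% h']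
  simp

/-- Slice form of `square_trans`: `σ` is natural with respect to `e`, and its component at an
identity is fixed by the unit axiom. -/
theorem conj_trans {G G' : C ⥤ᵖ D} (σ : G ⟶ G') {f : p ⟶ p} (e : f ≅ 𝟙 p)
    {f₁ : G.obj p ⟶ G.obj p} {f₂ : G'.obj p ⟶ G'.obj p} (e₁ : f₁ ≅ 𝟙 _) (e₂ : f₂ ≅ 𝟙 _)
    {m₁ : G.map f ⟶ f₁} {m₂ : G'.map f ⟶ f₂} {n : σ.app p ≫ f₂ ≅ f₁ ≫ σ.app p}
    (hm₁ : m₁ = (mapIsoId G e ≪≫ e₁.symm).hom) (hm₂ : m₂ = (mapIsoId G' e ≪≫ e₂.symm).hom)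
    (hn : n.hom = (conj e₁ e₂ (σ.app p)).hom) :
    (σ.naturality f).hom ≫ σ.app p ◁ m₂ = m₁ ▷ σ.app p ≫ n.inv := by
  obtain rfl := Iso.ext hn
  subst hm₁ hm₂
  simp only [conj, mapIsoId, Iso.trans_hom, Iso.trans_inv, whiskerLeftIso_inv,
    whiskerRightIso_inv, Iso.symm_hom, Iso.symm_inv, Category.assoc, comp_whiskerRight,
    whiskerLeft_comp, PrelaxFunctor.map₂Iso_hom]
  rw [← Pseudofunctor.StrongTrans.naturality_naturality_assoc,
    Pseudofunctor.StrongTrans.naturality_id_assoc]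
  simp

/-- Both sides trivialise `f` and then introduce another 1-arrow isomorphic to the identity. The
axioms `square_id` and `square_comp` reduce to this, the comparison 2-transformations having
identities as components. -/
theorem conj_id_eq {f f₁ f₂ : p ⟶ p} (e : f ≅ 𝟙 p) (e₁ : f₁ ≅ 𝟙 p) (e₂ : f₂ ≅ 𝟙 p)
    {m₁ : f ⟶ f₁} {m₂ : f ⟶ f₂} {n : 𝟙 p ≫ f₁ ≅ f₂ ≫ 𝟙 p} (hm₁ : m₁ = e.hom ≫ e₁.inv)
    (hm₂ : m₂ = e.hom ≫ e₂.inv) (hn : n.hom = (conj e₂ e₁ (𝟙 p)).hom) :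
    ((ρ_ f).hom ≫ (λ_ f).inv) ≫ 𝟙 p ◁ m₁ = m₂ ▷ 𝟙 p ≫ n.inv := by
  obtain rfl := Iso.ext hn
  subst hm₁ hm₂
  simp [conj, unitors_equal]

theorem conj_mapIdTrans {f f' : p ⟶ p} (e : f ≅ 𝟙 p) (e' : f' ≅ 𝟙 p) {m : f ⟶ f'}
    {n : 𝟙 p ≫ f ≅ f' ≫ 𝟙 p} (hm : m = (mapIsoId (Pseudofunctor.id C) e ≪≫ e'.symm).hom)
    (hn : n.hom = (conj e' e (𝟙 p)).hom) :
    (ρ_ f).hom ≫ (λ_ f).inv = m ▷ 𝟙 p ≫ n.inv := by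
  have := conj_id_eq e e e' (m₁ := 𝟙 f) (by simp)
    (hm.trans (congrArg (· ≫ e'.inv) (Category.comp_id e.hom))) hn
  simpa using this

variable {E : Type u''} [Bicategory.{w'', v''} E]

theorem conj_mapCompTrans (G : C ⥤ᵖ D) (H : D ⥤ᵖ E) {f : p ⟶ p} (e : f ≅ 𝟙 p)
    {f₁ : G.obj p ⟶ G.obj p} {f₂ f₃ : H.obj (G.obj p) ⟶ H.obj (G.obj p)} (e₁ : f₁ ≅ 𝟙 _)
    (e₂ : f₂ ≅ 𝟙 _) (e₃ : f₃ ≅ 𝟙 _) {m₁ : G.map f ⟶ f₁} {m₂ : H.map f₁ ⟶ f₂}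
    {m₃ : H.map (G.map f) ⟶ f₃} {n : 𝟙 (H.obj (G.obj p)) ≫ f₂ ≅ f₃ ≫ 𝟙 (H.obj (G.obj p))}
    (hm₁ : m₁ = (mapIsoId G e ≪≫ e₁.symm).hom) (hm₂ : m₂ = (mapIsoId H e₁ ≪≫ e₂.symm).hom)
    (hm₃ : m₃ = (mapIsoId (G.comp H) e ≪≫ e₃.symm).hom) (hn : n.hom = (conj e₃ e₂ (𝟙 _)).hom) :
    ((ρ_ (H.map (G.map f))).hom ≫ (λ_ (H.map (G.map f))).inv) ≫
      𝟙 (H.obj (G.obj p)) ◁ (H.map₂ m₁ ≫ m₂) = m₃ ▷ 𝟙 (H.obj (G.obj p)) ≫ n.inv := by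
  refine conj_id_eq (mapIsoId (G.comp H) e) e₂ e₃ ?_ hm₃ hn
  have h : (mapIsoId (G.comp H) e).hom =
      H.map₂ (G.map₂ e.hom) ≫ H.map₂ (G.mapId p).hom ≫ (H.mapId _).hom := rfl
  have h' : H.map₂ e₁.inv ≫ H.map₂ e₁.hom = 𝟙 _ := by
    rw [← PrelaxFunctor.map₂_comp, Iso.inv_hom_id, PrelaxFunctor.map₂_id]
  subst hm₁ hm₂
  refine Eq.trans ?_ (congrArg (· ≫ e₂.inv) h).symm
  simp only [mapIsoId, Iso.trans_hom, Iso.symm_hom, PrelaxFunctor.map₂_comp,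
    PrelaxFunctor.map₂Iso_hom, Category.assoc, reassoc_of% h']
  exact ((Category.assoc _ _ _).trans (congrArg (_ ≫ ·) (Category.assoc _ _ _))).symm

end Conj

namespace LocConstStack

/-! ### Parallel transport as an equivalence natural in the stalk 2-category. -/

section Transport

variable {X : Type*} [TopologicalSpace X] {C : Type u} [Bicategory.{w, v} C]

/-- An invertible 2-arrow is stalkwise invertible. -/
def isoApp {P Q : LocConstStack X C} {f g : P ⟶ Q} (e : f ≅ g) (x : X) : f.app x ≅ g.app x where
  hom := e.hom.app x
  inv := e.inv.app x
  hom_inv_id := congrArg (fun k : f ⟶ f => Hom₂.app k x) e.hom_inv_id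
  inv_hom_id := congrArg (fun k : g ⟶ g => Hom₂.app k x) e.inv_hom_id

/-- The map `ι_t ∘ p : X × I → X × I`, `(x, s) ↦ (x, t)`. -/
abbrev collapse (X : Type*) [TopologicalSpace X] (t : unitInterval) :
    C(X × unitInterval, X × unitInterval) :=
  (slice X t).comp (proj X)

variable (t : unitInterval) (S T : LocConstStack (X × unitInterval) C)

/-- The 1-arrow given by parallel transport from `t` along the segments `{x} × I`. -/
noncomputable def transport : pullbackObj (collapse X t) S ⟶ S :=
  -- `collapse ∘ slice` is definitionally `slice`, so both stacks have the same restriction to the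
  -- slice and its identity can be extended.
  (exists_hom_extension (P := pullbackObj (collapse X t) S) (Q := S) t
    (𝟙 (pullbackObj (slice X t) S))).choose

/-- Parallel transport from `t` restricts to the identity on the slice at `t`. -/
noncomputable def transportIso :
    (show pullbackObj (slice X t) S ⟶ pullbackObj (slice X t) S from
      pullbackHom (P := pullbackObj (collapse X t) S) (Q := S) (slice X t) (transport t S)) ≅ 𝟙 (pullbackObj (slice X t) S) :=
  (exists_hom_extension (P := pullbackObj (collapse X t) S) (Q := S) t
    (𝟙 (pullbackObj (slice X t) S))).choose_spec.some

/-- The 1-arrow given by parallel transport to `t` along the segments `{x} × I`. -/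
noncomputable def transportInv : S ⟶ pullbackObj (collapse X t) S :=
  (exists_hom_extension (P := S) (Q := pullbackObj (collapse X t) S) t
    (𝟙 (pullbackObj (slice X t) S))).choose

/-- Parallel transport to `t` restricts to the identity on the slice at `t`. -/
noncomputable def transportInvIso :
    (show pullbackObj (slice X t) S ⟶ pullbackObj (slice X t) S from
      pullbackHom (P := S) (Q := pullbackObj (collapse X t) S) (slice X t) (transportInv t S)) ≅ 𝟙 (pullbackObj (slice X t) S) :=
  (exists_hom_extension (P := S) (Q := pullbackObj (collapse X t) S) t
    (𝟙 (pullbackObj (slice X t) S))).choose_spec.some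

variable {S T}

theorem exists_transport_naturality (φ : S ⟶ T) :
    ∃ m : pullbackHom (collapse X t) φ ≫ transport t T ≅ transport t S ≫ φ, ∀ x,
      m.hom.app (x, t) =
        (conj (isoApp (transportIso t S) x) (isoApp (transportIso t T) x) (φ.app (x, t))).hom :=
  exists_iso_slice t (f := pullbackHom (collapse X t) φ ≫ transport t T) (g := transport t S ≫ φ)
    (conj (transportIso t S) (transportIso t T) (pullbackHom (slice X t) φ))

theorem exists_transportInv_naturality (φ : S ⟶ T) :
    ∃ m : φ ≫ transportInv t T ≅ transportInv t S ≫ pullbackHom (collapse X t) φ, ∀ x,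
      m.hom.app (x, t) = (conj (isoApp (transportInvIso t S) x)
        (isoApp (transportInvIso t T) x) (φ.app (x, t))).hom :=
  exists_iso_slice t (f := φ ≫ transportInv t T)
    (g := transportInv t S ≫ pullbackHom (collapse X t) φ)
    (conj (transportInvIso t S) (transportInvIso t T) (pullbackHom (slice X t) φ))

variable (S)

theorem exists_transport_unit :
    ∃ m : 𝟙 (pullbackObj (collapse X t) S) ≅ transport t S ≫ transportInv t S, ∀ x,
      m.hom.app (x, t) = (Iso.refl _ ≪≫
        (compId (isoApp (transportIso t S) x) (isoApp (transportInvIso t S) x)).symm).hom :=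
  exists_iso_slice t (f := 𝟙 (pullbackObj (collapse X t) S))
    (g := transport t S ≫ transportInv t S)
    (Iso.refl _ ≪≫ (compId (transportIso t S) (transportInvIso t S)).symm)

theorem exists_transport_counit :
    ∃ m : transportInv t S ≫ transport t S ≅ 𝟙 S, ∀ x,
      m.hom.app (x, t) =
        (compId (isoApp (transportInvIso t S) x) (isoApp (transportIso t S) x) ≪≫
          (Iso.refl _).symm).hom :=
  exists_iso_slice t (f := transportInv t S ≫ transport t S) (g := 𝟙 S)
    (compId (transportInvIso t S) (transportIso t S) ≪≫ (Iso.refl _).symm)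

/-- Both 1-arrows restrict on the slice to 1-arrows isomorphic to the identity, since `G` preserves
identities up to isomorphism. -/
theorem exists_transport_square {D : Type u'} [Bicategory.{w', v'} D] (G : C ⥤ᵖ D) :
    ∃ m : mapHom G (transport t S) ≅ transport t (mapObj G S), ∀ x,
      m.hom.app (x, t) = (mapIsoId G (isoApp (transportIso t S) x) ≪≫
        (isoApp (transportIso t (mapObj G S)) x).symm).hom :=
  exists_iso_slice t (f := mapHom G (transport t S)) (g := transport t (mapObj G S))
    (mapIsoId (map X G) (transportIso t S) ≪≫ (transportIso t (mapObj G S)).symm)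

variable (X C)

/-- Parallel transport as a 2-transformation. -/
noncomputable def transportTrans :
    pullback (collapse X t) C ⟶ pullback (ContinuousMap.id (X × unitInterval)) C where
  app S := transport t S
  naturality φ := (exists_transport_naturality t φ).choose
  naturality_naturality m := hom₂_ext_slice t fun x =>
    conj_naturality _ _ (m.app (x, t)) ((exists_transport_naturality t _).choose_spec x)
      ((exists_transport_naturality t _).choose_spec x)
  naturality_id S := hom₂_ext_slice t fun x =>
    conj_id _ ((exists_transport_naturality t (𝟙 S)).choose_spec x)
  naturality_comp φ ψ := hom₂_ext_slice t fun x =>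
    conj_comp _ _ _ ((exists_transport_naturality t (φ ≫ ψ)).choose_spec x)
      ((exists_transport_naturality t φ).choose_spec x)
      ((exists_transport_naturality t ψ).choose_spec x)

/-- Parallel transport to `t` as a 2-transformation. -/
noncomputable def transportInvTrans :
    pullback (ContinuousMap.id (X × unitInterval)) C ⟶ pullback (collapse X t) C where
  app S := transportInv t S
  naturality φ := (exists_transportInv_naturality t φ).choose
  naturality_naturality m := hom₂_ext_slice t fun x =>
    conj_naturality _ _ (m.app (x, t)) ((exists_transportInv_naturality t _).choose_spec x)
      ((exists_transportInv_naturality t _).choose_spec x)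
  naturality_id S := hom₂_ext_slice t fun x =>
    conj_id _ ((exists_transportInv_naturality t (𝟙 S)).choose_spec x)
  naturality_comp φ ψ := hom₂_ext_slice t fun x =>
    conj_comp _ _ _ ((exists_transportInv_naturality t (φ ≫ ψ)).choose_spec x)
      ((exists_transportInv_naturality t φ).choose_spec x)
      ((exists_transportInv_naturality t ψ).choose_spec x)

/-- Transport from `t` and back is isomorphic to the identity. -/
noncomputable def transportUnit :
    𝟙 (pullback (collapse X t) C) ≅ transportTrans X C t ≫ transportInvTrans X C t :=
  Pseudofunctor.StrongTrans.isoMk (fun S => (exists_transport_unit t S).choose) fun φ =>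
    hom₂_ext_slice t fun x => conj_modification _ _ _ _ (conj_refl _)
      (conj_vcomp _ _ _ _ ((exists_transport_naturality t φ).choose_spec x)
        ((exists_transportInv_naturality t φ).choose_spec x))
      ((exists_transport_unit t _).choose_spec x) ((exists_transport_unit t _).choose_spec x)

/-- Transport to `t` and back is isomorphic to the identity. -/
noncomputable def transportCounit :
    transportInvTrans X C t ≫ transportTrans X C t ≅
      𝟙 (pullback (ContinuousMap.id (X × unitInterval)) C) :=
  Pseudofunctor.StrongTrans.isoMk (fun S => (exists_transport_counit t S).choose) fun φ =>
    hom₂_ext_slice t fun x => conj_modification _ _ _ _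
      (conj_vcomp _ _ _ _ ((exists_transportInv_naturality t φ).choose_spec x)
        ((exists_transport_naturality t φ).choose_spec x)) (conj_refl _)
      ((exists_transport_counit t _).choose_spec x) ((exists_transport_counit t _).choose_spec x)

/-- Parallel transport is an equivalence of 2-functors. -/
noncomputable def transportEquivalence :
    pullback (collapse X t) C ≌ pullback (ContinuousMap.id (X × unitInterval)) C :=
  -- The triangle identity is achieved by changing the counit alone. The underlying 2-transformation
  -- remains `transportTrans`, which is all that the squares of `PullbackEquiv` involve.
  Bicategory.Equivalence.mkOfAdjointifyCounit (transportUnit X C t) (transportCounit X C t)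

/-- Parallel transport is natural in the 2-category of stalks. -/
noncomputable def collapsePullbackEquiv : PullbackEquiv.{w, v, u} (collapse X t)
    (ContinuousMap.id (X × unitInterval)) where
  equiv C _ := transportEquivalence X C t
  square G S := (exists_transport_square t S G).choose
  square_naturality G S T φ := hom₂_ext_slice t fun x =>
    conj_map G _ _ _ _ ((exists_transport_naturality t φ).choose_spec x)
      ((exists_transport_naturality t (mapHom G φ)).choose_spec x)
      ((exists_transport_square t S G).choose_spec x)
      ((exists_transport_square t T G).choose_spec x)
  square_trans {_ _ _ _ G G'} σ S := hom₂_ext_slice t fun x =>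
    conj_trans σ _ _ _ ((exists_transport_square t S G).choose_spec x)
      ((exists_transport_square t S G').choose_spec x)
      (n := isoApp (exists_transport_naturality t (mapTransApp σ S)).choose (x, t))
      ((exists_transport_naturality t (mapTransApp σ S)).choose_spec x)
  square_id S := hom₂_ext_slice t fun x =>
    conj_mapIdTrans _ _ ((exists_transport_square t S _).choose_spec x)
      (n := isoApp (exists_transport_naturality t (mapIdApp S)).choose (x, t))
      ((exists_transport_naturality t (mapIdApp S)).choose_spec x)
  square_comp G H S := hom₂_ext_slice t fun x =>
    conj_mapCompTrans G H _ _ _ _ ((exists_transport_square t S G).choose_spec x)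
      ((exists_transport_square t _ H).choose_spec x)
      ((exists_transport_square t S _).choose_spec x)
      (n := isoApp (exists_transport_naturality t (mapCompApp G H S)).choose (x, t))
      ((exists_transport_naturality t (mapCompApp G H S)).choose_spec x)

/-- The identity equivalence of inverse images. -/
noncomputable def idPullbackEquiv : PullbackEquiv.{w, v, u} (ContinuousMap.id X)
    (ContinuousMap.id X) where
  equiv _ _ := Bicategory.Equivalence.id _
  square G S := (map X G).mapId S
  square_naturality G _ _ _ := Hom₂.ext fun _ =>
    conj_map G (Iso.refl _) (Iso.refl _) (Iso.refl _) (Iso.refl _) (conj_refl _) (conj_refl _)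
      (mapId_hom_eq _ _) (mapId_hom_eq _ _)
  square_trans σ _ := Hom₂.ext fun _ =>
    conj_trans σ (Iso.refl _) (Iso.refl _) (Iso.refl _) (mapId_hom_eq _ _)
      (mapId_hom_eq _ _) (n := ρ_ _ ≪≫ (λ_ _).symm) (conj_refl _)
  square_id _ := Hom₂.ext fun _ =>
    conj_mapIdTrans (Iso.refl _) (Iso.refl _) (mapId_hom_eq _ _)
      (n := ρ_ _ ≪≫ (λ_ _).symm) (conj_refl _)
  square_comp G H _ := Hom₂.ext fun _ =>
    conj_mapCompTrans G H (Iso.refl _) (Iso.refl _) (Iso.refl _) (Iso.refl _)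
      (mapId_hom_eq _ _) (mapId_hom_eq _ _) (mapId_hom_eq _ _)
      (n := ρ_ _ ≪≫ (λ_ _).symm) (conj_refl _)

/-- Evaluation at an object of the inverse of an equivalence of 2-functors. -/
def equivalenceApp {B : Type u} [Bicategory.{w, v} B] {D : Type u'} [Bicategory.{w', v'} D]
    {F G : B ⥤ᵖ D} (e : F ≌ G) (b : B) : G.obj b ≌ F.obj b :=
  Bicategory.Equivalence.mkOfAdjointifyCounit (f := e.inv.app b) (g := e.hom.app b)
    ⟨e.counit.inv.as.app b, e.counit.hom.as.app b,
      congrArg (fun m : 𝟙 G ⟶ 𝟙 G => m.as.app b) e.counit.inv_hom_id,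
      congrArg (fun m : e.inv ≫ e.hom ⟶ e.inv ≫ e.hom => m.as.app b) e.counit.hom_inv_id⟩
    ⟨e.unit.inv.as.app b, e.unit.hom.as.app b,
      congrArg (fun m : e.hom ≫ e.inv ⟶ e.hom ≫ e.inv => m.as.app b) e.unit.inv_hom_id,
      congrArg (fun m : 𝟙 F ⟶ 𝟙 F => m.as.app b) e.unit.hom_inv_id⟩

end Transport

end LocConstStack

end HigherMonodromy

/-! ### Homotopy invariance. -/

theorem mainTheorem9 (X : Type z) [TopologicalSpace X] (t : unitInterval) :
    (Nonempty (LocConstStack.PullbackEquiv.{w, v, u}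
        ((LocConstStack.proj X).comp (LocConstStack.slice X t)) (ContinuousMap.id X)) ∧
      Nonempty (LocConstStack.PullbackEquiv.{w, v, u}
        ((LocConstStack.slice X t).comp (LocConstStack.proj X))
        (ContinuousMap.id (X × unitInterval)))) ∧
    ∀ (C : Type u) [Bicategory.{w, v} C],
      Nonempty
        ((LocConstStack.pullback (LocConstStack.proj X) C).comp
            (LocConstStack.pullback (LocConstStack.slice X t) C) ≌
          Pseudofunctor.id (LocConstStack X C)) ∧
      Nonempty
        ((LocConstStack.pullback (LocConstStack.slice X t) C).comp
            (LocConstStack.pullback (LocConstStack.proj X) C) ≌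
          Pseudofunctor.id (LocConstStack (X × unitInterval) C)) ∧
      ∀ S : LocConstStack (X × unitInterval) C,
        Nonempty (S ≌ (LocConstStack.pullback (LocConstStack.proj X) C).obj
          ((LocConstStack.pullback (LocConstStack.slice X t) C).obj S)) := by
  have h : (LocConstStack.proj X).comp (LocConstStack.slice X t) = ContinuousMap.id X := rfl
  refine ⟨⟨⟨LocConstStack.idPullbackEquiv X⟩, ⟨LocConstStack.collapsePullbackEquiv X t⟩⟩,
    fun C _ => ⟨?_, ?_, fun S => ?_⟩⟩
  · rw [← LocConstStack.pullback_comp, h, LocConstStack.pullback_id]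
    exact ⟨Bicategory.Equivalence.id _⟩
  · rw [← LocConstStack.pullback_comp, ← LocConstStack.pullback_id]
    exact ⟨LocConstStack.transportEquivalence X C t⟩
  -- The inverse image of `S` along `ι_t ∘ p` is definitionally the iterated one, so the stalkwise
  -- form of the equivalence applies directly.
  · exact ⟨(LocConstStack.equivalenceApp (LocConstStack.transportEquivalence X C t) S)⟩
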